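/- Let $f=(f_1,f_2,f_3):\mathbb{R}^3\to\mathbb{R}^3$ be a polynomial mapping, $J=\det Df$, and for $1\le i<j\le 3$ put $$K_{ij}=\nabla f_i\times\nabla f_j,\quad X_{ij}=\langle\nabla J,K_{ij}\rangle,\quad Y_{ij}=\langle\nabla X_{ij},K_{ij}\rangle,\quad Z_{ij}=\langle\nabla Y_{ij},K_{ij}\rangle,\quad g_{ij}=Z_{ij}\cdot\det D(J,X_{ij},Y_{ij}).$$ In $\mathbb{R}[x,y,z]$ let $I_1$ be the ideal generated by $J,\partial J/\partial x,\partial J/\partial y,\partial J/\partial z$; let $I_2$ be generated by $J$ and all $2\times2$ minors of $Df$; let $I_3$ be generated by $J,X_{12},X_{13},X_{23}$ and all $2\times 2$ minors of $D(J,X_{12},X_{13},X_{23})$; and let $I$ be generated by $J$, all $X_{ij}$ and all $Y_{ij}$. Put $\mathcal{A}=\mathbb{R}[x,y,z]/I$. Let $g=\sum_{i<j}\alpha_{ij}g_{ij}$ with real numbers $\alpha_{ij}\ge 0$, at least one of them positive, and let $u\in\mathbb{R}[x,y,z]$. If $\dim_{\mathbb{R}}\mathcal{A}<\infty$, let $t(a)$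 be the trace of multiplication by $a$ on $\mathcal{A}$, consider the quadratic forms on $\mathcal{A}$ $$\Theta(h)=t(h^2),\quad \Psi(h)=t(gh^2),\quad \Phi_1(h)=t(uh^2),\quad \Phi_2(h)=t(ugh^2),$$ and let $\sigma$ denote the signature of a quadratic form. Let $S_1(f)=\{p\in\mathbb{R}^3 : \operatorname{rank}Df(p)=2\}$, $S_{1,1}(f)=\{p\in S_1(f) : \operatorname{rank}D(f|S_1(f))(p)=1\}$ and $S_{1,1,1}(f)=\{p\in S_{1,1}(f) : \operatorname{rank}D(f|S_{1,1}(f))(p)=0\}$ (under the assumptions below $S_1(f)$ and $S_{1,1}(f)$ are smooth submanifolds of $\mathbb{R}^3$, possibly empty, and the ranks are those of $Df(p)$ restricted to their tangent spaces at $p$). Let $p$ be a point with $\operatorname{rank}Df(p)=2$, and let $K$ be a smooth vector field near $p$ with $K(p)\neq0$ and $Df(q)K(q)=0$ for all $q\in S_1(f)$ near $p$. Put $X=\langle\nabla J,K\rangle$, $Y=\langle\nabla X,K\rangle$, $Z=\langle\nabla Y,K\rangle$. The point $p$ is a simple swallowtail of $f$ if $J(p)=X(p)=Y(p)=0$ and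 $\nabla J(p),\nabla X(p),\nabla Y(p)$ are linearly independent; its sign is then $I(f,p)=\operatorname{sgn}\bigl(Z(p)\det[\nabla J(p),\nabla X(p),\nabla Y(p)]\bigr)\in\{+1,-1\}$. Neither notion depends on the choice of $K$. **Theorem.** Assume that $I_1=I_2=I_3=\mathbb{R}[x,y,z]$ and $\dim_{\mathbb{R}}\mathcal{A}<\infty$, and that the quadratic forms $\Psi,\Phi_1,\Phi_2$ are non-degenerate. Then $S_{1,1,1}(f)$ is finite, all its points are simple swallowtails, and $$\#\{p\in S_{1,1,1}(f) : u(p)>0\}=\frac{\sigma(\Theta)+\sigma(\Phi_1)}{2},$$ $$\#\{p\in S_{1,1,1}(f) : I(f,p)=+1,\ u(p)>0\}=\frac{\sigma(\Theta)+\sigma(\Psi)+\sigma(\Phi_1)+\sigma(\Phi_2)}{4},$$ $$\#\{p\in S_{1,1,1}(f) : I(f,p)=-1,\ u(p)>0\}=\frac{\sigma(\Theta)-\sigma(\Psi)+\sigma(\Phi_1)-\sigma(\Phi_2)}{4}.$$ -/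

import Mathlib

open MvPolynomial
open scoped Gradient ContDiff Matrix

namespace Swallowtail

noncomputable section

/-! ### Smooth mappings of Euclidean 3-space -/

/-- Euclidean 3-space with its standard scalar product. -/
abbrev E3 : Type := EuclideanSpace ℝ (Fin 3)

/-- The tangent space at `p` of a submanifold `S`: the linear span of the tangent cone of `S` at `p`
(for a submanifold the tangent cone is already the tangent space). -/
def tangentSpaceOf (S : Set E3) (p : E3) : Submodule ℝ E3 :=
  Submodule.span ℝ (tangentConeAt ℝ S p)

/-- The rank of `D(f|S)(p) : T_p S → ℝ³`, the restriction of `Df(p)` to the tangent space. -/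
def rankRestrict (f : E3 → E3) (S : Set E3) (p : E3) : ℕ :=
  Module.finrank ℝ ((tangentSpaceOf S p).map (fderiv ℝ f p).toLinearMap)

/-- `S₁(f) = {p | rank Df(p) = 2}`. -/
def S₁ (f : E3 → E3) : Set E3 :=
  {p | Module.finrank ℝ (LinearMap.range (fderiv ℝ f p).toLinearMap) = 2}

/-- `S₁₁(f) = {p ∈ S₁(f) | rank D(f|S₁(f))(p) = 1}`. -/
def S₁₁ (f : E3 → E3) : Set E3 :=
  {p | p ∈ S₁ f ∧ rankRestrict f (S₁ f) p = 1}

/-- `S₁₁₁(f) = {p ∈ S₁₁(f) | rank D(f|S₁₁(f))(p) = 0}`. -/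
def S₁₁₁ (f : E3 → E3) : Set E3 :=
  {p | p ∈ S₁₁ f ∧ rankRestrict f (S₁₁ f) p = 0}

/-- The Jacobian determinant `J = det Df`. -/
def jacobian (f : E3 → E3) (p : E3) : ℝ := (fderiv ℝ f p).det

/-- The function `⟨∇φ, K⟩`. -/
def derivAlong (K : E3 → E3) (φ : E3 → ℝ) (p : E3) : ℝ := inner ℝ (∇ φ p) (K p)

/-- `X = ⟨∇J, K⟩`. -/
def fieldX (f K : E3 → E3) : E3 → ℝ := derivAlong K (jacobian f)

/-- `Y = ⟨∇X, K⟩`. -/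
def fieldY (f K : E3 → E3) : E3 → ℝ := derivAlong K (fieldX f K)

/-- `Z = ⟨∇Y, K⟩`. -/
def fieldZ (f K : E3 → E3) : E3 → ℝ := derivAlong K (fieldY f K)

/-- The three gradients `∇J(p), ∇X(p), ∇Y(p)`. -/
def gradients (f K : E3 → E3) (p : E3) : Fin 3 → E3 :=
  ![∇ (jacobian f) p, ∇ (fieldX f K) p, ∇ (fieldY f K) p]

/-- `K` is a germ at `p` of a smooth vector field with `K(p) ≠ 0` which lies in the kernel of `Df`
along `S₁(f)`. -/
structure IsKernelField (f : E3 → E3) (p : E3) (K : E3 → E3) : Prop where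
  smooth : ContDiffAt ℝ ∞ K p
  ne_zero : K p ≠ 0
  mem_ker : ∀ᶠ q in nhds p, q ∈ S₁ f → fderiv ℝ f q (K q) = 0

/-- `p` is a simple swallowtail point of `f`, as witnessed by the kernel field `K`. -/
structure IsSimpleSwallowtailWith (f : E3 → E3) (p : E3) (K : E3 → E3) : Prop where
  smooth : ContDiffAt ℝ ∞ f p
  rank_eq : Module.finrank ℝ (LinearMap.range (fderiv ℝ f p).toLinearMap) = 2
  kernelField : IsKernelField f p K
  J_eq : jacobian f p = 0
  X_eq : fieldX f K p = 0
  Y_eq : fieldY f K p = 0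
  linearIndependent : LinearIndependent ℝ (gradients f K p)

/-- `p` is a simple swallowtail point of `f`. -/
def IsSimpleSwallowtail (f : E3 → E3) (p : E3) : Prop :=
  ∃ K : E3 → E3, IsSimpleSwallowtailWith f p K

open Classical in
/-- The sign `I(f,p) = sgn (Z(p) · det[∇J(p), ∇X(p), ∇Y(p)])` of a simple swallowtail point, computed
with any kernel field `K` (the value is `0` if `p` is not a simple swallowtail point). -/
def swallowtailSign (f : E3 → E3) (p : E3) : SignType :=
  if h : IsSimpleSwallowtail f p then
    SignType.sign (fieldZ f h.choose p *
      (Matrix.of fun i j => gradients f h.choose p i j).det)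
  else 0

/-! ### Polynomial mappings -/

/-- The polynomial ring `ℝ[x,y,z]`. -/
abbrev Poly3 : Type := MvPolynomial (Fin 3) ℝ

/-- The polynomial mapping `ℝ³ → ℝ³` with components `f`. -/
def polyMap (f : Fin 3 → Poly3) (p : E3) : E3 :=
  WithLp.toLp 2 fun i => eval (fun j => p j) (f i)

/-- The gradient of a polynomial. -/
def grad (P : Poly3) : Fin 3 → Poly3 := fun j => pderiv j P

/-- The derivative matrix of a tuple of polynomials; row `i` is the gradient of `F i`. -/
def derivMatrix {m : ℕ} (F : Fin m → Poly3) : Matrix (Fin m) (Fin 3) Poly3 :=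
  Matrix.of fun i => grad (F i)

/-- The set of all `2 × 2` minors of a matrix of polynomials. -/
def minors₂ {m n : ℕ} (M : Matrix (Fin m) (Fin n) Poly3) : Set Poly3 :=
  {d | ∃ i i' : Fin m, ∃ j j' : Fin n, i < i' ∧ j < j' ∧
    d = Matrix.det !![M i j, M i j'; M i' j, M i' j']}

/-- The polynomial `J = det Df`. -/
def polyJ (f : Fin 3 → Poly3) : Poly3 := (derivMatrix f).det

/-- `K_ij = ∇f_i × ∇f_j`. -/
def polyK (f : Fin 3 → Poly3) (i j : Fin 3) : Fin 3 → Poly3 := grad (f i) ⨯₃ grad (f j)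

/-- `X_ij = ⟨∇J, K_ij⟩`. -/
def polyX (f : Fin 3 → Poly3) (i j : Fin 3) : Poly3 := grad (polyJ f) ⬝ᵥ polyK f i j

/-- `Y_ij = ⟨∇X_ij, K_ij⟩`. -/
def polyY (f : Fin 3 → Poly3) (i j : Fin 3) : Poly3 := grad (polyX f i j) ⬝ᵥ polyK f i j

/-- `Z_ij = ⟨∇Y_ij, K_ij⟩`. -/
def polyZ (f : Fin 3 → Poly3) (i j : Fin 3) : Poly3 := grad (polyY f i j) ⬝ᵥ polyK f i j

/-- `g_ij = Z_ij · det D(J, X_ij, Y_ij)`. -/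
def polyG (f : Fin 3 → Poly3) (i j : Fin 3) : Poly3 :=
  polyZ f i j * (derivMatrix ![polyJ f, polyX f i j, polyY f i j]).det

/-- `I₁`: the ideal generated by `J` and its partial derivatives. -/
def ideal₁ (f : Fin 3 → Poly3) : Ideal Poly3 :=
  Ideal.span ({polyJ f} ∪ Set.range (grad (polyJ f)))

/-- `I₂`: the ideal generated by `J` and the `2 × 2` minors of `Df`. -/
def ideal₂ (f : Fin 3 → Poly3) : Ideal Poly3 :=
  Ideal.span ({polyJ f} ∪ minors₂ (derivMatrix f))

/-- `I₃`: the ideal generated by `J, X₁₂, X₁₃, X₂₃` and the `2 × 2` minors of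
`D(J, X₁₂, X₁₃, X₂₃)`. -/
def ideal₃ (f : Fin 3 → Poly3) : Ideal Poly3 :=
  Ideal.span ({polyJ f, polyX f 0 1, polyX f 0 2, polyX f 1 2} ∪
    minors₂ (derivMatrix ![polyJ f, polyX f 0 1, polyX f 0 2, polyX f 1 2]))

/-- `I`: the ideal generated by `J`, all `X_ij` and all `Y_ij`. -/
def idealI (f : Fin 3 → Poly3) : Ideal Poly3 :=
  Ideal.span {polyJ f, polyX f 0 1, polyX f 0 2, polyX f 1 2,
    polyY f 0 1, polyY f 0 2, polyY f 1 2}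

/-- The algebra `𝒜 = ℝ[x,y,z]/I`. -/
abbrev AlgA (f : Fin 3 → Poly3) : Type := Poly3 ⧸ idealI f

/-- The quadratic form `h ↦ t(v h²)` on `𝒜`, where `t(a)` is the trace of multiplication by `a`. -/
def traceQuad (f : Fin 3 → Poly3) (v : Poly3) : QuadraticForm ℝ (AlgA f) :=
  LinearMap.BilinMap.toQuadraticMap
    ((LinearMap.mul ℝ (AlgA f)).compr₂
      (Algebra.trace ℝ (AlgA f) ∘ₗ LinearMap.mulLeft ℝ (Ideal.Quotient.mk (idealI f) v)))

theorem traceQuad_apply (f : Fin 3 → Poly3) (v : Poly3) (h : AlgA f) :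
    traceQuad f v h = Algebra.trace ℝ (AlgA f) (Ideal.Quotient.mk (idealI f) v * h ^ 2) := by
  simp [traceQuad, pow_two]

/-- The signature of a real quadratic form. -/
def signature {V : Type*} [AddCommGroup V] [Module ℝ V] (Q : QuadraticForm ℝ V) : ℤ :=
  (sigPos Q : ℤ) - (sigNeg Q : ℤ)

end

end Swallowtail

open Swallowtail

namespace Swallowtail

noncomputable section

/-! ### Signatures of trace forms -/

/-! The algebraic half counts real points by trace forms. A nilpotent element lies in the radical of
every form `h ↦ t(v h²)`, so one nondegenerate such form makes `𝒜` reduced, hence a finite product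
of copies of `ℝ` and `ℂ`. Complex factors contribute signature zero, and a real point `p`
contributes the sign of `v(p)` (`signature_traceSq`). Nondegeneracy also makes `v` a unit, so `v(p)
≠ 0`.

The geometric half identifies `S₁₁₁(f)` with the real zeros of `I`. If `J(p) = 0`, then `I₂ = (1)`
makes some `K_ij(p)` nonzero, and it spans the kernel of `Df`. Since `I₁` and `I₃` are the unit
ideal, `{J = 0}` and, near `p`, `{J = X_ij = 0}` are regular level sets, and the rank drops on them
exactly when `K_ij` is tangent: `X_ij = 0`, then `Y_ij = 0` (`mem_S₁₁_iff`,
`mem_S₁₁₁_iff_of_ne_zero`). Any other kernel field equals `c K_ij` along `{J = 0}`; this changes the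
gradients of `J, X, Y` by a triangular matrix with diagonal `1, c, c²`, and `Z` by `c³`. The
vanishing conditions therefore pass to every `X_lm`, `Y_lm`, and the sign is unchanged because `c⁶ >
0` (`sign_data`).

Reducedness forces the gradients of `I` to span at each real zero, so the points are simple
swallowtails. There `g` has the sign `I(f,p)`, and the counts follow by expanding `1 + sgn u` and
`(1 ± sgn g)(1 + sgn u)`. -/

theorem signature_eq_of_equivalent {V W : Type*} [AddCommGroup V] [Module ℝ V] [AddCommGroup W]
    [Module ℝ W] {Q : QuadraticForm ℝ V} {Q' : QuadraticForm ℝ W}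
    (h : QuadraticMap.Equivalent Q Q') : signature Q = signature Q' := by
  rw [signature, signature, h.sigPos_eq, h.sigNeg_eq]

theorem signature_weightedSumSquares {ι : Type*} [Fintype ι] (w : ι → ℝ) :
    signature (QuadraticMap.weightedSumSquares ℝ w) = ∑ i, (SignType.sign (w i) : ℤ) := by
  classical
  rw [signature, QuadraticForm.sigPos_weightedSumSquares, QuadraticForm.sigNeg_weightedSumSquares,
    Set.ncard_eq_toFinset_card', Set.ncard_eq_toFinset_card', Finset.card_eq_sum_ones,
    Finset.card_eq_sum_ones]
  simp only [Set.toFinset_ofPred, Finset.sum_filter, Nat.cast_sum, ← Finset.sum_sub_distrib]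
  refine Finset.sum_congr rfl fun i _ => ?_
  rcases lt_trichotomy (w i) 0 with h | h | h
  · simp [h, h.le]
  · simp [h]
  · simp [h, h.le]

/-- Diagonalising each factor and concatenating the weights diagonalises the product. -/
theorem signature_pi {ι : Type*} [Fintype ι] {V : ι → Type*} [∀ i, AddCommGroup (V i)]
    [∀ i, Module ℝ (V i)] [∀ i, FiniteDimensional ℝ (V i)] (Q : ∀ i, QuadraticForm ℝ (V i)) :
    signature (QuadraticMap.pi Q) = ∑ i, signature (Q i) := by
  have : Invertible (2 : ℝ) := invertibleOfNonzero two_ne_zero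
  choose w hw using fun i => (Q i).equivalent_weightedSumSquares
  have e : QuadraticMap.Equivalent
      (QuadraticMap.pi fun i => QuadraticMap.weightedSumSquares ℝ (w i))
      (QuadraticMap.weightedSumSquares ℝ
        fun s : Σ i, Fin (Module.finrank ℝ (V i)) => w s.1 s.2) :=
    ⟨{ (LinearEquiv.piCurry ℝ fun i (_ : Fin (Module.finrank ℝ (V i))) => ℝ).symm with
        map_app' := fun x => by
          simp [QuadraticMap.weightedSumSquares_apply, Fintype.sum_sigma, Sigma.uncurry] }⟩
  rw [signature_eq_of_equivalent (QuadraticMap.Equivalent.pi hw), signature_eq_of_equivalent e,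
    signature_weightedSumSquares, Fintype.sum_sigma]
  refine Finset.sum_congr rfl fun i _ => ?_
  rw [signature_eq_of_equivalent (hw i), signature_weightedSumSquares]

/-- The quadratic form `h ↦ tr (v h²)` on a commutative real algebra. -/
def traceSq (A : Type*) [CommRing A] [Algebra ℝ A] (v : A) : QuadraticForm ℝ A :=
  LinearMap.BilinMap.toQuadraticMap
    ((LinearMap.mul ℝ A).compr₂ (Algebra.trace ℝ A ∘ₗ LinearMap.mulLeft ℝ v))

theorem traceSq_apply {A : Type*} [CommRing A] [Algebra ℝ A] (v h : A) :
    traceSq A v h = Algebra.trace ℝ A (v * (h * h)) := by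
  simp [traceSq]

theorem traceQuad_eq_traceSq (f : Fin 3 → Poly3) (v : Poly3) :
    traceQuad f v = traceSq (AlgA f) (Ideal.Quotient.mk (idealI f) v) := rfl

theorem traceSq_equivalent {A B : Type*} [CommRing A] [Algebra ℝ A] [CommRing B] [Algebra ℝ B]
    (e : A ≃ₐ[ℝ] B) (v : A) : QuadraticMap.Equivalent (traceSq A v) (traceSq B (e v)) :=
  ⟨{ e.toLinearEquiv with
      map_app' := fun x => by
        simp [traceSq_apply, ← map_mul, Algebra.trace_eq_of_algEquiv] }⟩

theorem trace_pi {ι : Type*} [Fintype ι] {K : ι → Type*} [∀ i, CommRing (K i)]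
    [∀ i, Algebra ℝ (K i)] [∀ i, FiniteDimensional ℝ (K i)] (x : ∀ i, K i) :
    Algebra.trace ℝ (∀ i, K i) x = ∑ i, Algebra.trace ℝ (K i) (x i) := by
  classical
  let b := fun i => Module.finBasis ℝ (K i)
  rw [Algebra.trace_eq_matrix_trace (Pi.basis b), Matrix.trace, Fintype.sum_sigma]
  refine Finset.sum_congr rfl fun i _ => ?_
  rw [Algebra.trace_eq_matrix_trace (b i), Matrix.trace]
  refine Finset.sum_congr rfl fun j _ => ?_
  simp [Algebra.leftMulMatrix_eq_repr_mul]

theorem traceSq_pi {ι : Type*} [Fintype ι] {K : ι → Type*} [∀ i, CommRing (K i)]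
    [∀ i, Algebra ℝ (K i)] [∀ i, FiniteDimensional ℝ (K i)] (v : ∀ i, K i) :
    traceSq (∀ i, K i) v = QuadraticMap.pi fun i => traceSq (K i) (v i) := by
  ext h
  simp [traceSq_apply, trace_pi]

theorem signature_traceSq_real (a : ℝ) : signature (traceSq ℝ a) = SignType.sign a := by
  have e : QuadraticMap.Equivalent (traceSq ℝ a)
      (QuadraticMap.weightedSumSquares ℝ fun _ : Unit => a) :=
    ⟨{ (LinearEquiv.funUnique Unit ℝ ℝ).symm with
        map_app' := fun x => by
          simp [QuadraticMap.weightedSumSquares_apply, traceSq_apply] }⟩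
  rw [signature_eq_of_equivalent e, signature_weightedSumSquares]
  simp

/-- A trace form has signature zero when the algebra contains a square root of `-1`. -/
theorem signature_traceSq_eq_zero {A : Type*} [CommRing A] [Algebra ℝ A] (i : A) (hi : i * i = -1)
    (v : A) : signature (traceSq A v) = 0 := by
  -- Multiplication by `i` is an isometry from the form to its negative.
  let m : A ≃ₗ[ℝ] A := LinearEquiv.ofLinearMap (LinearMap.mulLeft ℝ i) (LinearMap.mulLeft ℝ (-i))
    (by ext x; simp [← mul_assoc, hi]) (by ext x; simp [← mul_assoc, hi])
  have hm : ∀ x, m x = i * x := fun _ => rfl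
  have e : QuadraticMap.Equivalent (traceSq A v) (-traceSq A v) :=
    ⟨{ m with
        map_app' := fun x => by
          have : v * (i * x * (i * x)) = -(v * (x * x)) := by linear_combination v * x * x * hi
          simp [hm, traceSq_apply, this] }⟩
  have := signature_eq_of_equivalent e
  simp only [signature, sigPos_neg, sigNeg_neg] at this ⊢
  lia

/-- The kernel of a real point of an algebra, as a maximal ideal. -/
def kerMax {A : Type*} [CommRing A] [Algebra ℝ A] (φ : A →ₐ[ℝ] ℝ) : MaximalSpectrum A :=
  ⟨RingHom.ker φ, RingHom.ker_isMaximal_of_surjective φ fun r => ⟨algebraMap ℝ A r, by simp⟩⟩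

theorem kerMax_injective {A : Type*} [CommRing A] [Algebra ℝ A] :
    Function.Injective (kerMax (A := A)) := by
  intro φ ψ h
  ext a
  have h1 : a - algebraMap ℝ A (φ a) ∈ (kerMax φ).asIdeal := by
    simp [kerMax, RingHom.mem_ker]
  rw [h] at h1
  simp only [kerMax, RingHom.mem_ker, map_sub, AlgHom.commutes, Algebra.algebraMap_self,
    RingHom.id_apply] at h1
  linarith

/-- The signature of a trace form on a reduced finite-dimensional real algebra is the sum of the
signs at its real points. -/
theorem signature_traceSq {A : Type*} [CommRing A] [Algebra ℝ A] [FiniteDimensional ℝ A]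
    [IsReduced A] [Fintype (A →ₐ[ℝ] ℝ)] (v : A) :
    signature (traceSq A v) = ∑ φ : A →ₐ[ℝ] ℝ, (SignType.sign (φ v) : ℤ) := by
  have : IsArtinianRing A := isArtinian_of_tower ℝ inferInstance
  have : Fintype (MaximalSpectrum A) := Fintype.ofFinite _
  let e := (IsArtinianRing.equivPi A).restrictScalars ℝ
  rw [signature_eq_of_equivalent (traceSq_equivalent e v), traceSq_pi, signature_pi]
  symm
  refine Fintype.sum_of_injective kerMax kerMax_injective _ _ (fun m hm => ?_) fun φ => ?_
  -- A residue field is `ℝ` or `ℂ`; the first case would make `m` the kernel of a real point, and in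
  -- the second the signature vanishes.
  · let _ : Field (A ⧸ m.asIdeal) := Ideal.Quotient.field _
    rcases Real.nonempty_algEquiv_or (A ⧸ m.asIdeal) with ⟨⟨ε⟩⟩ | ⟨⟨ε⟩⟩
    · refine absurd ⟨(ε : A ⧸ m.asIdeal →ₐ[ℝ] ℝ).comp (Ideal.Quotient.mkₐ ℝ m.asIdeal), ?_⟩ hm
      ext a
      simp [kerMax, RingHom.mem_ker, Ideal.Quotient.eq_zero_iff_mem]
    · refine signature_traceSq_eq_zero (ε.symm Complex.I) ?_ _
      rw [← map_mul, Complex.I_mul_I, map_neg, map_one]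
  · have ε : (A ⧸ (kerMax φ).asIdeal) ≃ₐ[ℝ] ℝ :=
      Ideal.quotientKerAlgEquivOfSurjective (f := φ) fun r => ⟨algebraMap ℝ A r, by simp⟩
    have h : ε (Ideal.Quotient.mk _ v) = φ v := by
      have h1 : v - algebraMap ℝ A (φ v) ∈ (kerMax φ).asIdeal := by
        simp [kerMax, RingHom.mem_ker]
      rw [(Ideal.Quotient.mk_eq_mk_iff_sub_mem _ _).2 h1]
      exact ε.commutes (φ v)
    rw [← signature_traceSq_real, ← h]
    exact (signature_eq_of_equivalent (traceSq_equivalent ε _)).symm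

/-! ### Consequences of nondegeneracy of a trace form -/

theorem mem_radical_traceSq {A : Type*} [CommRing A] [Algebra ℝ A] {v a : A}
    (h : ∀ b, Algebra.trace ℝ A (v * (a * b)) = 0) : a ∈ (traceSq A v).radical := by
  have : Invertible (2 : ℝ) := invertibleOfNonzero two_ne_zero
  rw [QuadraticMap.radical_eq_ker_polarBilin, LinearMap.mem_ker]
  ext b
  have : v * ((a + b) * (a + b)) = v * (a * a) + v * (a * b) + v * (a * b) + v * (b * b) := by ring
  simp [QuadraticMap.polar, traceSq_apply, this, h]

/-- Multiples of a nilpotent element are nilpotent, so their traces vanish and the element lies in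
the radical. -/
theorem isReduced_of_traceSq_nondegenerate {A : Type*} [CommRing A] [Algebra ℝ A] {v : A}
    (hv : (traceSq A v).Nondegenerate) : IsReduced A := by
  refine ⟨fun a ha => ?_⟩
  have h : a ∈ (traceSq A v).radical := mem_radical_traceSq fun b => by
    have hn : IsNilpotent (v * (a * b)) :=
      (Commute.all _ _).isNilpotent_mul_left ((Commute.all _ _).isNilpotent_mul_right ha)
    exact (LinearMap.isNilpotent_trace_of_isNilpotent (hn.map (Algebra.lmul ℝ A))).eq_zero
  rwa [hv.radical_eq_bot] at h

/-- The annihilator of `v` lies in the radical, and in an Artinian ring a nonzerodivisor is a unit.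
-/
theorem isUnit_of_traceSq_nondegenerate {A : Type*} [CommRing A] [Algebra ℝ A]
    [FiniteDimensional ℝ A] {v : A} (hv : (traceSq A v).Nondegenerate) : IsUnit v := by
  have : IsArtinianRing A := isArtinian_of_tower ℝ inferInstance
  refine IsArtinianRing.isUnit_of_mem_nonZeroDivisors
    (mem_nonZeroDivisors_iff_right.2 fun a ha => ?_)
  have h : a ∈ (traceSq A v).radical := mem_radical_traceSq fun b => by
    rw [show v * (a * b) = a * v * b by ring, ha, zero_mul, map_zero]
  rwa [hv.radical_eq_bot] at h

/-- In a reduced finite-dimensional algebra the functions vanishing at a real point are killed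
by an element not vanishing there. -/
theorem exists_annihilator_of_realPoint {A : Type*} [CommRing A] [Algebra ℝ A]
    [FiniteDimensional ℝ A] [IsReduced A] (φ : A →ₐ[ℝ] ℝ) :
    ∃ e : A, φ e ≠ 0 ∧ ∀ a, φ a = 0 → a * e = 0 := by
  classical
  have : IsArtinianRing A := isArtinian_of_tower ℝ inferInstance
  let E := IsArtinianRing.equivPi A
  -- The witness is the idempotent of the factor belonging to `φ`.
  refine ⟨E.symm (Pi.single (kerMax φ) 1), fun h => ?_, fun a ha => E.injective ?_⟩
  · have h1 : E.symm (Pi.single (kerMax φ) 1) ∈ (kerMax φ).asIdeal := h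
    rw [← Ideal.Quotient.eq_zero_iff_mem] at h1
    have h2 := IsArtinianRing.equivPi_apply A (E.symm (Pi.single (kerMax φ) 1)) (kerMax φ)
    rw [h1] at h2
    have h3 : E (E.symm (Pi.single (kerMax φ) 1)) (kerMax φ) = 0 := h2
    rw [AlgEquiv.apply_symm_apply, Pi.single_eq_same] at h3
    have := Ideal.Quotient.nontrivial_iff.2 (kerMax φ).isMaximal.ne_top
    exact one_ne_zero h3
  · rw [map_mul, AlgEquiv.apply_symm_apply, map_zero]
    ext m
    by_cases hm : m = kerMax φ
    · subst hm
      have h1 : a ∈ (kerMax φ).asIdeal := ha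
      rw [← Ideal.Quotient.eq_zero_iff_mem] at h1
      have h2 : E a (kerMax φ) = 0 := (IsArtinianRing.equivPi_apply A a (kerMax φ)).trans h1
      rw [Pi.mul_apply, h2, zero_mul, Pi.zero_apply]
    · rw [Pi.mul_apply, Pi.single_eq_of_ne hm, mul_zero, Pi.zero_apply]

/-! ### Gradients and tangent spaces of level sets -/

theorem toDual_gradient_apply (φ : E3 → ℝ) (p v : E3) : inner ℝ (∇ φ p) v = fderiv ℝ φ p v := by
  simp [gradient]

theorem gradient_sub_apply {φ ψ : E3 → ℝ} {p : E3} (hφ : DifferentiableAt ℝ φ p)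
    (hψ : DifferentiableAt ℝ ψ p) : ∇ (fun q => φ q - ψ q) p = ∇ φ p - ∇ ψ p := by
  simp [gradient, fderiv_fun_sub hφ hψ]

theorem gradient_mul_apply {φ ψ : E3 → ℝ} {p : E3} (hφ : DifferentiableAt ℝ φ p)
    (hψ : DifferentiableAt ℝ ψ p) :
    ∇ (fun q => φ q * ψ q) p = φ p • ∇ ψ p + ψ p • ∇ φ p := by
  simp [gradient, fderiv_fun_mul hφ hψ]

theorem contDiffAt_gradient {φ : E3 → ℝ} {p : E3} (h : ContDiffAt ℝ ∞ φ p) :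
    ContDiffAt ℝ ∞ (∇ φ) p :=
  (InnerProductSpace.toDual ℝ E3).symm.contDiff.contDiffAt.comp p
    (h.fderiv_right (m := ∞) (by simp))

theorem contDiffAt_derivAlong {φ : E3 → ℝ} {K : E3 → E3} {p : E3} (hφ : ContDiffAt ℝ ∞ φ p)
    (hK : ContDiffAt ℝ ∞ K p) : ContDiffAt ℝ ∞ (derivAlong K φ) p :=
  (contDiffAt_gradient hφ).inner ℝ hK

/-- Being constant on `S`, `φ` also has derivative `0` within `S`, and derivatives within `S` agree
on the tangent cone. -/
theorem tangentSpaceOf_le_ker {G : Type*} [NormedAddCommGroup G] [NormedSpace ℝ G] {φ : E3 → G}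
    {φ' : E3 →L[ℝ] G} {S : Set E3} {p : E3} {c : G} (hφ : HasFDerivAt φ φ' p)
    (hS : ∀ᶠ q in nhds p, q ∈ S → φ q = c) (hp : φ p = c) :
    tangentSpaceOf S p ≤ LinearMap.ker φ'.toLinearMap := by
  refine Submodule.span_le.2 fun v hv => ?_
  have h0 : HasFDerivWithinAt φ (0 : E3 →L[ℝ] G) S p :=
    (hasFDerivWithinAt_const c p S).congr_of_eventuallyEq (eventually_nhdsWithin_iff.2 hS) hp
  exact hφ.hasFDerivWithinAt.unique_on h0 hv

/-- The implicit function parametrises the level set by the kernel of `F'`, and its derivative at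
`0` is the inclusion of that kernel. -/
theorem ker_le_tangentSpaceOf {G : Type*} [NormedAddCommGroup G] [NormedSpace ℝ G]
    [FiniteDimensional ℝ G] {F : E3 → G} {F' : E3 →L[ℝ] G} {S : Set E3} {p : E3}
    (hF : HasStrictFDerivAt F F' p) (hF' : F'.range = ⊤)
    (hS : ∀ᶠ q in nhds p, F q = F p → q ∈ S) :
    LinearMap.ker F'.toLinearMap ≤ tangentSpaceOf S p := by
  intro v hv
  let γ := hF.implicitFunction F F' hF' (F p)
  have hγ0 : γ 0 = p := hF.implicitFunction_apply_image hF'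
  have hγ : HasStrictFDerivAt γ F'.ker.subtypeL 0 := hF.to_implicitFunction hF'
  have hlev : ∀ᶠ y in nhds (0 : F'.ker), F (γ y) = F p :=
    (Continuous.prodMk_right (F p)).continuousAt.eventually (hF.map_implicitFunction_eq hF')
  have hmem : γ ⁻¹' S ∈ nhds (0 : F'.ker) := by
    have h1 : ∀ᶠ y in nhds (0 : F'.ker), F (γ y) = F p → γ y ∈ S :=
      hγ.continuousAt.eventually (by rwa [hγ0])
    filter_upwards [hlev, h1] with y h2 h3 using h3 h2
  have h := hγ.hasFDerivAt.hasFDerivWithinAt (s := γ ⁻¹' S) |>.mapsTo_tangent_cone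
  rw [tangentConeAt_of_mem_nhds hmem, hγ0] at h
  exact Submodule.subset_span
    (tangentConeAt_mono (Set.image_preimage_subset γ S) (h (Set.mem_univ ⟨v, hv⟩)))

/-- A nonzero functional vanishing on the range would be a linear relation among the `w i`. -/
theorem range_pi_inner_eq_top {ι : Type*} [Fintype ι] {w : ι → E3} (hw : LinearIndependent ℝ w) :
    (ContinuousLinearMap.pi fun i => innerSL ℝ (w i)).range = ⊤ := by
  classical
  by_contra h
  obtain ⟨l, hl, hle⟩ := Submodule.exists_le_ker_of_lt_top _ (lt_top_iff_ne_top.2 h)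
  have key : ∑ i, l (Pi.single i 1) • w i = 0 := by
    refine ext_inner_right ℝ fun v => ?_
    have h1 : l (fun i => inner ℝ (w i) v) = 0 := hle ⟨v, rfl⟩
    rw [LinearMap.pi_apply_eq_sum_univ] at h1
    simp only [sum_inner, inner_smul_left, inner_zero_left]
    rw [← h1]
    refine Finset.sum_congr rfl fun i _ => ?_
    have : (fun j => if i = j then (1 : ℝ) else 0) = Pi.single i 1 := by
      ext j; simp [Pi.single_apply, eq_comm]
    simp [this, mul_comm]
  have hz := Fintype.linearIndependent_iff.1 hw _ key
  refine hl (LinearMap.pi_ext' fun i => LinearMap.ext_ring ?_)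
  simpa using hz i

section LevelSet

variable {ι : Type*} {F : ι → E3 → ℝ} {p : E3}

theorem hasStrictFDerivAt_pi_gradient [Fintype ι] (hF : ∀ i, ContDiffAt ℝ 1 (F i) p) :
    HasStrictFDerivAt (fun q i => F i q)
      (ContinuousLinearMap.pi fun i => innerSL ℝ (∇ (F i) p)) p := by
  refine hasStrictFDerivAt_pi.2 fun i => ?_
  have h : innerSL ℝ (∇ (F i) p) = fderiv ℝ (F i) p := by
    ext v; simp
  rw [h]
  exact (hF i).hasStrictFDerivAt one_ne_zero

theorem ker_pi_inner (w : ι → E3) :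
    LinearMap.ker (ContinuousLinearMap.pi fun i => innerSL ℝ (w i)).toLinearMap =
      (Submodule.span ℝ (Set.range w))ᗮ := by
  ext v
  simp only [LinearMap.mem_ker, Submodule.mem_orthogonal]
  constructor
  · intro h u hu
    have hv : ∀ i, inner ℝ (w i) v = 0 := fun i => congrFun h i
    induction hu using Submodule.span_induction with
    | mem u hu => obtain ⟨i, rfl⟩ := hu; exact hv i
    | zero => simp
    | add a b _ _ ha hb => rw [inner_add_left, ha, hb, add_zero]
    | smul r a _ ha => rw [inner_smul_left, ha, mul_zero]
  · intro h
    ext i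
    exact h _ (Submodule.subset_span ⟨i, rfl⟩)

/-- The tangent space of a regular level set is the orthogonal complement of the gradients. -/
theorem tangentSpaceOf_levelSet [Fintype ι] {S : Set E3} (hF : ∀ i, ContDiffAt ℝ 1 (F i) p)
    (hli : LinearIndependent ℝ fun i => ∇ (F i) p) (hp : ∀ i, F i p = 0)
    (hS : ∀ᶠ q in nhds p, q ∈ S ↔ ∀ i, F i q = 0) :
    tangentSpaceOf S p = (Submodule.span ℝ (Set.range fun i => ∇ (F i) p))ᗮ := by
  have hd := hasStrictFDerivAt_pi_gradient hF
  rw [← ker_pi_inner]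
  refine le_antisymm (tangentSpaceOf_le_ker (c := 0) hd.hasFDerivAt ?_ (funext hp))
    (ker_le_tangentSpaceOf hd (range_pi_inner_eq_top hli) ?_)
  · filter_upwards [hS] with q hq hqS using funext (hq.1 hqS)
  · filter_upwards [hS] with q hq hqS
    exact hq.2 fun i => (congrFun hqS i).trans (hp i)

/-- A function vanishing on a regular level set has its gradient in the span of the gradients of the
defining functions. -/
theorem gradient_mem_span_of_vanishing [Fintype ι] {φ : E3 → ℝ} (hF : ∀ i, ContDiffAt ℝ 1 (F i) p)
    (hli : LinearIndependent ℝ fun i => ∇ (F i) p) (hp : ∀ i, F i p = 0)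
    (hφ : DifferentiableAt ℝ φ p) (hz : ∀ᶠ q in nhds p, (∀ i, F i q = 0) → φ q = 0) :
    ∇ φ p ∈ Submodule.span ℝ (Set.range fun i => ∇ (F i) p) := by
  have h := tangentSpaceOf_le_ker (S := {q | ∀ i, F i q = 0}) hφ.hasFDerivAt hz
    (hz.self_of_nhds hp)
  rw [tangentSpaceOf_levelSet (S := {q | ∀ i, F i q = 0}) hF hli hp (.of_forall fun _ => Iff.rfl)] at h
  rw [← Submodule.orthogonal_orthogonal (Submodule.span ℝ _), Submodule.mem_orthogonal']
  intro v hv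
  rw [toDual_gradient_apply]
  exact h hv

end LevelSet

theorem exists_gradient_eq_smul {J φ : E3 → ℝ} {p : E3} (hJ : ContDiffAt ℝ 1 J p)
    (hne : ∇ J p ≠ 0) (hp : J p = 0) (hφ : DifferentiableAt ℝ φ p)
    (hz : ∀ᶠ q in nhds p, J q = 0 → φ q = 0) : ∃ a : ℝ, ∇ φ p = a • ∇ J p := by
  have h := gradient_mem_span_of_vanishing (F := fun _ : Unit => J) (fun _ => hJ)
    (LinearIndependent.of_subsingleton () hne) (fun _ => hp) hφ
    (by filter_upwards [hz] with q hq h using hq (h ()))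
  rw [Set.range_const, Submodule.mem_span_singleton] at h
  obtain ⟨a, ha⟩ := h
  exact ⟨a, ha.symm⟩

theorem exists_gradient_eq_smul_add_smul {J X φ : E3 → ℝ} {p : E3} (hJ : ContDiffAt ℝ 1 J p)
    (hX : ContDiffAt ℝ 1 X p) (hli : LinearIndependent ℝ ![∇ J p, ∇ X p]) (hJp : J p = 0)
    (hXp : X p = 0) (hφ : DifferentiableAt ℝ φ p)
    (hz : ∀ᶠ q in nhds p, J q = 0 → X q = 0 → φ q = 0) :
    ∃ a b : ℝ, ∇ φ p = a • ∇ J p + b • ∇ X p := by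
  have e : (fun i => ∇ ((![J, X] : Fin 2 → E3 → ℝ) i) p) = ![∇ J p, ∇ X p] := by
    ext i : 1; fin_cases i <;> rfl
  have h := gradient_mem_span_of_vanishing (F := ![J, X])
    (by simp [Fin.forall_fin_two, hJ, hX]) (e ▸ hli) (by simp [Fin.forall_fin_two, hJp, hXp]) hφ
    (by filter_upwards [hz] with q hq h using hq (h 0) (h 1))
  rw [e, Matrix.range_cons_cons_empty, Submodule.mem_span_pair] at h
  obtain ⟨a, b, hab⟩ := h
  exact ⟨a, b, hab.symm⟩

/-! ### Change of the kernel field -/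

/-- Along the zero set of `J` the field `K'` is the multiple `c` of the field `K`. -/
structure IsMultipleField (J : E3 → ℝ) (K K' : E3 → E3) (c : E3 → ℝ) (p : E3) : Prop where
  smoothJ : ContDiffAt ℝ ∞ J p
  smoothK : ContDiffAt ℝ ∞ K p
  smoothK' : ContDiffAt ℝ ∞ K' p
  smoothc : ContDiffAt ℝ ∞ c p
  zero : J p = 0
  gradient_ne_zero : ∇ J p ≠ 0
  eq_smul : ∀ᶠ q in nhds p, J q = 0 → K' q = c q • K q

/-- The quotient of inner products is a smooth extension, off `{J = 0}`, of the proportionality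
factor. -/
theorem IsMultipleField.of_parallel {J : E3 → ℝ} {K K' : E3 → E3} {p : E3}
    (hJ : ContDiffAt ℝ ∞ J p) (hK : ContDiffAt ℝ ∞ K p) (hK' : ContDiffAt ℝ ∞ K' p)
    (hp : J p = 0) (hgrad : ∇ J p ≠ 0) (hKp : K p ≠ 0)
    (hpar : ∀ᶠ q in nhds p, J q = 0 → ∃ r : ℝ, K' q = r • K q) :
    IsMultipleField J K K' (fun q => inner ℝ (K q) (K' q) / inner ℝ (K q) (K q)) p where
  smoothJ := hJ
  smoothK := hK
  smoothK' := hK'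
  smoothc := (hK.inner ℝ hK').div (hK.inner ℝ hK) (by simpa using hKp)
  zero := hp
  gradient_ne_zero := hgrad
  eq_smul := by
    filter_upwards [hpar, hK.continuousAt.eventually_ne hKp] with q hq hne h
    obtain ⟨r, hr⟩ := hq h
    have : inner ℝ (K q) (K q) ≠ 0 := by simpa using hne
    rw [hr, inner_smul_right, mul_div_cancel_right₀ _ this]

namespace IsMultipleField

variable {J : E3 → ℝ} {K K' : E3 → E3} {c : E3 → ℝ} {p : E3}

/-- With `X = ⟨∇J, K⟩` and `X' = ⟨∇J, K'⟩`, the function `X' - cX` vanishes on `{J = 0}`, so its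
gradient there is a multiple of `∇J`. The statement covers all nearby zeros of `J` because the
result is used again along `{J = X = 0}`. -/
theorem exists_gradient_derivAlong (h : IsMultipleField J K K' c p) :
    ∀ᶠ q in nhds p, J q = 0 → ∃ a : ℝ, ∇ (derivAlong K' J) q =
      c q • ∇ (derivAlong K J) q + derivAlong K J q • ∇ c q + a • ∇ J q := by
  have hX := contDiffAt_derivAlong h.smoothJ h.smoothK
  have hX' := contDiffAt_derivAlong h.smoothJ h.smoothK'
  have ev {φ : E3 → ℝ} (hφ : ContDiffAt ℝ ∞ φ p) : ∀ᶠ q in nhds p, ContDiffAt ℝ 1 φ q :=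
    (hφ.of_le (by simp)).eventually (by simp)
  filter_upwards [ev hX, ev hX', ev h.smoothJ, ev h.smoothc,
    (contDiffAt_gradient h.smoothJ).continuousAt.eventually_ne h.gradient_ne_zero,
    h.eq_smul.eventually_nhds] with q hX hX' hJ hc hne hK hq
  have dX := hX.differentiableAt one_ne_zero
  have dX' := hX'.differentiableAt one_ne_zero
  have dc := hc.differentiableAt one_ne_zero
  obtain ⟨a, ha⟩ := exists_gradient_eq_smul (φ := fun q => derivAlong K' J q - c q * derivAlong K J q)
    hJ hne hq (dX'.sub (dc.fun_mul dX)) (by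
      filter_upwards [hK] with r hr h0
      simp [derivAlong, hr h0, inner_smul_right])
  rw [gradient_sub_apply dX' (dc.fun_mul dX), gradient_mul_apply dc dX, sub_eq_iff_eq_add] at ha
  exact ⟨a, by rw [ha]; abel⟩

/-- Pairing the previous formula with `K' = cK` kills the `∇c` term, whose coefficient is `X = 0`,
and the `∇J` term, since `⟨∇J, K⟩ = X = 0`. -/
theorem derivAlong_derivAlong (h : IsMultipleField J K K' c p) :
    ∀ᶠ q in nhds p, J q = 0 → derivAlong K J q = 0 →
      derivAlong K' (derivAlong K' J) q = c q ^ 2 * derivAlong K (derivAlong K J) q := by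
  filter_upwards [h.exists_gradient_derivAlong, h.eq_smul] with q h1 h2 hJ hX
  obtain ⟨a, ha⟩ := h1 hJ
  have hX' : inner ℝ (∇ J q) (K q) = 0 := hX
  rw [derivAlong, ha, hX, h2 hJ]
  simp [inner_add_left, inner_smul_left, inner_smul_right, hX', derivAlong]
  ring

/-- The function `Y' - c²Y` vanishes on the regular level set `{J = X = 0}`; the term `Y ∇(c²)`
drops out because `Y(p) = 0`. -/
theorem exists_gradient_derivAlong_derivAlong (h : IsMultipleField J K K' c p)
    (hX : derivAlong K J p = 0) (hY : derivAlong K (derivAlong K J) p = 0)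
    (hli : LinearIndependent ℝ ![∇ J p, ∇ (derivAlong K J) p]) :
    ∃ a b : ℝ, ∇ (derivAlong K' (derivAlong K' J)) p =
      c p ^ 2 • ∇ (derivAlong K (derivAlong K J)) p + a • ∇ J p + b • ∇ (derivAlong K J) p := by
  have sX := contDiffAt_derivAlong h.smoothJ h.smoothK
  have sY := contDiffAt_derivAlong sX h.smoothK
  have sY' := contDiffAt_derivAlong (contDiffAt_derivAlong h.smoothJ h.smoothK') h.smoothK'
  have dY := sY.differentiableAt (by simp)
  have dY' := sY'.differentiableAt (by simp)
  have dc : DifferentiableAt ℝ (fun q => c q ^ 2) p := (h.smoothc.differentiableAt (by simp)).pow 2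
  obtain ⟨a, b, hab⟩ := exists_gradient_eq_smul_add_smul
    (φ := fun q => derivAlong K' (derivAlong K' J) q - c q ^ 2 * derivAlong K (derivAlong K J) q)
    (h.smoothJ.of_le (by simp)) (sX.of_le (by simp)) hli h.zero hX (dY'.sub (dc.fun_mul dY)) (by
      filter_upwards [h.derivAlong_derivAlong] with q hq h1 h2
      rw [hq h1 h2, sub_self])
  rw [gradient_sub_apply dY' (dc.fun_mul dY), gradient_mul_apply dc dY, hY, zero_smul, add_zero,
    sub_eq_iff_eq_add] at hab
  exact ⟨a, b, by rw [hab]; abel⟩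

/-- The product defining the sign of a swallowtail changes by a sixth power. -/
theorem sign_data (h : IsMultipleField J K K' c p)
    (hX : derivAlong K J p = 0) (hY : derivAlong K (derivAlong K J) p = 0)
    (hli : LinearIndependent ℝ ![∇ J p, ∇ (derivAlong K J) p]) :
    derivAlong K' (derivAlong K' (derivAlong K' J)) p *
      (Matrix.of fun i j => (![∇ J p, ∇ (derivAlong K' J) p,
        ∇ (derivAlong K' (derivAlong K' J)) p] : Fin 3 → E3) i j).det =
    c p ^ 6 * (derivAlong K (derivAlong K (derivAlong K J)) p *
      (Matrix.of fun i j => (![∇ J p, ∇ (derivAlong K J) p,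
        ∇ (derivAlong K (derivAlong K J)) p] : Fin 3 → E3) i j).det) := by
  obtain ⟨a, ha⟩ := h.exists_gradient_derivAlong.self_of_nhds h.zero
  obtain ⟨b, d, hbd⟩ := h.exists_gradient_derivAlong_derivAlong hX hY hli
  have hX' : inner ℝ (∇ J p) (K p) = 0 := hX
  have hY' : inner ℝ (∇ (derivAlong K J) p) (K p) = 0 := hY
  -- `Z` contributes `c³`; the determinant contributes another `c · c²`, the remaining terms being
  -- row operations.
  have hZ : derivAlong K' (derivAlong K' (derivAlong K' J)) p =
      c p ^ 3 * derivAlong K (derivAlong K (derivAlong K J)) p := by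
    rw [derivAlong, hbd, h.eq_smul.self_of_nhds h.zero]
    simp only [inner_add_left, inner_smul_left, inner_smul_right, hX', hY',
      derivAlong.eq_1 K (derivAlong K (derivAlong K J))]
    simp
    ring
  rw [hZ, ha, hbd, hX]
  simp [Matrix.det_fin_three]
  ring

end IsMultipleField

/-! ### Polynomials as functions on Euclidean space -/

/-- The polynomial function of `P`. -/
def ev (P : Poly3) : E3 → ℝ := fun q => eval (fun j => q j) P

/-- The polynomial vector field with components `V`. -/
def vec (V : Fin 3 → Poly3) : E3 → E3 := fun q => WithLp.toLp 2 fun j => ev (V j) q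

@[simp] theorem vec_apply (V : Fin 3 → Poly3) (q : E3) (j : Fin 3) : vec V q j = ev (V j) q := rfl

@[simp] theorem ev_add (P Q : Poly3) (p : E3) : ev (P + Q) p = ev P p + ev Q p := by simp [ev]
@[simp] theorem ev_sub (P Q : Poly3) (p : E3) : ev (P - Q) p = ev P p - ev Q p := by simp [ev]
@[simp] theorem ev_mul (P Q : Poly3) (p : E3) : ev (P * Q) p = ev P p * ev Q p := by simp [ev]
@[simp] theorem ev_C (a : ℝ) (p : E3) : ev (C a) p = a := by simp [ev]
@[simp] theorem ev_X (j : Fin 3) (p : E3) : ev (X j) p = p j := by simp [ev]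
@[simp] theorem ev_zero (p : E3) : ev 0 p = 0 := by simp [ev]
@[simp] theorem ev_one (p : E3) : ev 1 p = 1 := by simp [ev]

theorem ev_det {n : ℕ} (M : Matrix (Fin n) (Fin n) Poly3) (p : E3) :
    ev M.det p = (M.map fun P => ev P p).det :=
  (eval fun j => p j).map_det M

theorem ev_dotProduct (V W : Fin 3 → Poly3) (p : E3) :
    ev (V ⬝ᵥ W) p = inner ℝ (vec V p) (vec W p) := by
  simp [dotProduct, PiLp.inner_apply, Fin.sum_univ_three, mul_comm]

theorem hasFDerivAt_ev (P : Poly3) (p : E3) :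
    HasFDerivAt (ev P) (innerSL ℝ (vec (grad P) p)) p := by
  induction P using MvPolynomial.induction_on with
  | C a =>
    have h : vec (grad (C a)) p = 0 := by ext j; simp [grad]
    rw [h, map_zero]
    exact (hasFDerivAt_const a p).congr_of_eventuallyEq (.of_forall fun q => by simp)
  | add P Q hP hQ =>
    have h : vec (grad (P + Q)) p = vec (grad P) p + vec (grad Q) p := by ext j; simp [grad]
    rw [h, map_add]
    exact (hP.add hQ).congr_of_eventuallyEq (.of_forall fun q => by simp)
  | mul_X P i hP =>
    have hX : HasFDerivAt (fun q : E3 => q i) (EuclideanSpace.proj i : E3 →L[ℝ] ℝ) p :=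
      (EuclideanSpace.proj i : E3 →L[ℝ] ℝ).hasFDerivAt
    refine ((hP.mul hX).congr_of_eventuallyEq (.of_forall fun q => by simp)).congr_fderiv ?_
    ext v
    simp only [add_apply, smul_apply, innerSL_apply_apply,
      PiLp.inner_apply, Fin.sum_univ_three, vec_apply, grad, pderiv_mul, ev_add, ev_mul, ev_X]
    fin_cases i <;> simp [pderiv_X] <;> ring

theorem gradient_ev (P : Poly3) : ∇ (ev P) = vec (grad P) := by
  ext1 p
  refine ext_inner_right ℝ fun v => ?_
  rw [toDual_gradient_apply, (hasFDerivAt_ev P p).fderiv, innerSL_apply_apply]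

theorem contDiff_ev (P : Poly3) {n : WithTop ℕ∞} : ContDiff ℝ n (ev P) := by
  induction P using MvPolynomial.induction_on with
  | C a => simpa only [funext (ev_C a)] using contDiff_const
  | add P Q hP hQ => simpa only [← funext (ev_add P Q)] using hP.add hQ
  | mul_X P i hP =>
    have h : ev (P * X i) = fun q => ev P q * (EuclideanSpace.proj i : E3 →L[ℝ] ℝ) q := by
      ext q; simp
    rw [h]
    exact hP.mul (EuclideanSpace.proj i : E3 →L[ℝ] ℝ).contDiff

theorem contDiff_vec (V : Fin 3 → Poly3) {n : WithTop ℕ∞} : ContDiff ℝ n (vec V) :=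
  contDiff_euclidean.2 fun j => contDiff_ev (V j)

theorem derivAlong_ev (V : Fin 3 → Poly3) (P : Poly3) :
    derivAlong (vec V) (ev P) = ev (grad P ⬝ᵥ V) := by
  ext p
  rw [derivAlong, gradient_ev, ev_dotProduct]

/-- The Jacobian matrix of a polynomial mapping at a point. -/
def jacMatrix (f : Fin 3 → Poly3) (p : E3) : Matrix (Fin 3) (Fin 3) ℝ :=
  (derivMatrix f).map fun P => ev P p

theorem hasFDerivAt_polyMap (f : Fin 3 → Poly3) (p : E3) :
    HasFDerivAt (polyMap f)
      (LinearMap.toContinuousLinearMap (Matrix.toEuclideanLin (jacMatrix f p))) p := by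
  refine hasFDerivWithinAt_univ.1 (hasFDerivWithinAt_euclidean.2 fun i => ?_)
  refine (hasFDerivAt_ev (f i) p).hasFDerivWithinAt.congr_fderiv ?_
  ext v
  simp [jacMatrix, derivMatrix, Matrix.mulVec, dotProduct, PiLp.inner_apply, mul_comm,
    Matrix.toLpLin_apply]

theorem fderiv_polyMap (f : Fin 3 → Poly3) (p : E3) :
    (fderiv ℝ (polyMap f) p).toLinearMap = Matrix.toEuclideanLin (jacMatrix f p) := by
  rw [(hasFDerivAt_polyMap f p).fderiv]
  rfl

theorem contDiff_polyMap (f : Fin 3 → Poly3) {n : WithTop ℕ∞} : ContDiff ℝ n (polyMap f) :=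
  contDiff_euclidean.2 fun i => contDiff_ev (f i)

theorem ev_polyJ (f : Fin 3 → Poly3) (p : E3) : ev (polyJ f) p = (jacMatrix f p).det :=
  ev_det _ p

theorem jacobian_polyMap (f : Fin 3 → Poly3) : jacobian (polyMap f) = ev (polyJ f) := by
  ext p
  rw [ev_polyJ, jacobian, ContinuousLinearMap.det, fderiv_polyMap]
  exact LinearMap.det_toLin (PiLp.basisFun 2 ℝ (Fin 3)) (jacMatrix f p)

theorem fieldX_polyMap (f : Fin 3 → Poly3) (i j : Fin 3) :
    fieldX (polyMap f) (vec (polyK f i j)) = ev (polyX f i j) := by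
  rw [fieldX, jacobian_polyMap, derivAlong_ev, polyX]

theorem fieldY_polyMap (f : Fin 3 → Poly3) (i j : Fin 3) :
    fieldY (polyMap f) (vec (polyK f i j)) = ev (polyY f i j) := by
  rw [fieldY, fieldX_polyMap, derivAlong_ev, polyY]

theorem fieldZ_polyMap (f : Fin 3 → Poly3) (i j : Fin 3) :
    fieldZ (polyMap f) (vec (polyK f i j)) = ev (polyZ f i j) := by
  rw [fieldZ, fieldY_polyMap, derivAlong_ev, polyZ]

theorem vec_polyK (f : Fin 3 → Poly3) (i j : Fin 3) (p : E3) :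
    vec (polyK f i j) p = WithLp.toLp 2 (jacMatrix f p i ⨯₃ jacMatrix f p j) := by
  ext l
  fin_cases l <;> simp [polyK, cross_apply, jacMatrix, derivMatrix]

/-! ### The kernel of a singular `3 × 3` matrix -/

theorem mulVec_cross_eq_zero {M : Matrix (Fin 3) (Fin 3) ℝ} (hM : M.det = 0) (i j : Fin 3) :
    M *ᵥ (M i ⨯₃ M j) = 0 := by
  ext l
  -- Each entry is a triple product of rows of `M`, hence the determinant of a row selection times
  -- `M`.
  have h : (![M l, M i, M j] : Matrix (Fin 3) (Fin 3) ℝ) =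
      (1 : Matrix (Fin 3) (Fin 3) ℝ).submatrix ![l, i, j] id * M := by
    rw [← Matrix.submatrix_id_id M, ← Matrix.submatrix_mul _ _ _ _ _ Function.bijective_id,
      one_mul, Matrix.submatrix_id_id]
    ext a b
    fin_cases a <;> rfl
  change M l ⬝ᵥ (M i ⨯₃ M j) = 0
  rw [triple_product_eq_det, h, Matrix.det_mul, hM, mul_zero]

/-- A vector orthogonal to both rows has zero cross product with `M i ⨯₃ M j`, so it is parallel to
it. -/
theorem exists_eq_smul_cross {M : Matrix (Fin 3) (Fin 3) ℝ} {i j : Fin 3} {v : Fin 3 → ℝ}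
    (h : M i ⨯₃ M j ≠ 0) (hv : M *ᵥ v = 0) : ∃ a : ℝ, a • (M i ⨯₃ M j) = v := by
  by_contra hne
  push Not at hne
  refine crossProduct_ne_zero_iff_linearIndependent.2 ((LinearIndependent.pair_iff' h).2 hne) ?_
  have hi : M i ⬝ᵥ v = 0 := congrFun hv i
  have hj : M j ⬝ᵥ v = 0 := congrFun hv j
  rw [cross_cross_eq_smul_sub_smul, hi, hj, zero_smul, zero_smul, sub_zero]

/-! ### The singular strata as polynomial zero sets -/

section Geometry

variable {f : Fin 3 → Poly3} {p : E3}

theorem fderiv_polyMap_apply (f : Fin 3 → Poly3) (p v : E3) :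
    fderiv ℝ (polyMap f) p v = WithLp.toLp 2 (jacMatrix f p *ᵥ v.ofLp) := by
  have h := congrArg (fun L => L v) (fderiv_polyMap f p)
  exact h.trans (by simp [Matrix.toLpLin_apply])

theorem fderiv_polyMap_vec_polyK (hJ : ev (polyJ f) p = 0) (i j : Fin 3) :
    fderiv ℝ (polyMap f) p (vec (polyK f i j) p) = 0 := by
  rw [fderiv_polyMap_apply, vec_polyK, mulVec_cross_eq_zero (by rw [← ev_polyJ, hJ])]
  rfl

theorem exists_eq_smul_vec_polyK {i j : Fin 3} (hK : vec (polyK f i j) p ≠ 0) {v : E3}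
    (hv : fderiv ℝ (polyMap f) p v = 0) : ∃ a : ℝ, v = a • vec (polyK f i j) p := by
  rw [fderiv_polyMap_apply] at hv
  rw [vec_polyK] at hK ⊢
  obtain ⟨a, ha⟩ := exists_eq_smul_cross (M := jacMatrix f p) (i := i) (j := j) (v := v.ofLp)
    (fun h => hK (by rw [h]; rfl)) (by simpa using hv)
  exact ⟨a, by rw [← WithLp.toLp_smul, ha]⟩

theorem ker_fderiv_polyMap (hJ : ev (polyJ f) p = 0) {i j : Fin 3}
    (hK : vec (polyK f i j) p ≠ 0) :
    LinearMap.ker (fderiv ℝ (polyMap f) p).toLinearMap = Submodule.span ℝ {vec (polyK f i j) p} := by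
  refine le_antisymm (fun v hv => ?_) ?_
  · obtain ⟨a, ha⟩ := exists_eq_smul_vec_polyK hK hv
    exact Submodule.mem_span_singleton.2 ⟨a, ha.symm⟩
  · rw [Submodule.span_singleton_le_iff_mem]
    exact fderiv_polyMap_vec_polyK hJ i j

theorem not_forall_ev_eq_zero {s : Set Poly3} (h : Ideal.span s = ⊤)
    (hs : ∀ P ∈ s, ev P p = 0) : False := by
  have hle : Ideal.span s ≤ RingHom.ker (eval fun j => p j) := Ideal.span_le.2 hs
  rw [h] at hle
  have h1 : ev 1 p = 0 := hle Submodule.mem_top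
  simp at h1

theorem gradient_polyJ_ne_zero (h₁ : ideal₁ f = ⊤) (hJ : ev (polyJ f) p = 0) :
    ∇ (ev (polyJ f)) p ≠ 0 := by
  intro h
  rw [gradient_ev] at h
  refine not_forall_ev_eq_zero (p := p) h₁ ?_
  rintro P (rfl | ⟨j, rfl⟩)
  · exact hJ
  · exact congrArg (fun w : E3 => w j) h

/-- The components of the `K_ij` are, up to sign, the `2 × 2` minors of `Df`; they cannot all vanish
together with `J`. -/
theorem exists_vec_polyK_ne_zero (h₂ : ideal₂ f = ⊤) (hJ : ev (polyJ f) p = 0) :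
    ∃ i j : Fin 3, i < j ∧ vec (polyK f i j) p ≠ 0 := by
  by_contra h
  push Not at h
  refine not_forall_ev_eq_zero (p := p) h₂ ?_
  rintro P (rfl | ⟨i, i', j, j', hi, hj, rfl⟩)
  · exact hJ
  · have h0 : ∀ l, ev (polyK f i i' l) p = 0 := fun l => congrArg (fun w : E3 => w l) (h i i' hi)
    have h1 := h0 0
    have h2 := h0 1
    have h3 := h0 2
    simp only [polyK, cross_apply, Matrix.cons_val, ev_sub, ev_mul] at h1 h2 h3
    rw [Matrix.det_fin_two_of, ev_sub, ev_mul, ev_mul]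
    simp only [derivMatrix, Matrix.of_apply]
    fin_cases j <;> fin_cases j' <;> first | exact absurd hj (by decide) | skip
    · simpa using h3
    · simp only [Fin.zero_eta, Fin.reduceFinMk]; linarith
    · simpa using h1

theorem mem_S₁_iff (h₂ : ideal₂ f = ⊤) : p ∈ S₁ (polyMap f) ↔ ev (polyJ f) p = 0 := by
  have hsum := (fderiv ℝ (polyMap f) p).toLinearMap.finrank_range_add_finrank_ker
  rw [finrank_euclideanSpace_fin] at hsum
  constructor
  · intro h
    rw [← jacobian_polyMap]
    by_contra hne
    have hbot := LinearMap.ker_eq_bot.2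
      (LinearMap.equivOfDetNeZero (fderiv ℝ (polyMap f) p).toLinearMap hne).injective
    have h' : Module.finrank ℝ (LinearMap.range (fderiv ℝ (polyMap f) p).toLinearMap) = 2 := h
    have hk : LinearMap.ker (fderiv ℝ (polyMap f) p).toLinearMap = ⊥ := hbot
    rw [h', hk, finrank_bot] at hsum
    lia
  · intro h
    obtain ⟨i, j, -, hK⟩ := exists_vec_polyK_ne_zero h₂ h
    rw [ker_fderiv_polyMap h hK, finrank_span_singleton hK] at hsum
    exact Nat.succ_injective hsum

/-- This and the next lemma translate a rank condition on a tangent space into tangency of the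
kernel direction `k`. -/
theorem finrank_map_of_mem {V W : Type*} [AddCommGroup V] [Module ℝ V] [FiniteDimensional ℝ V]
    [AddCommGroup W] [Module ℝ W] (D : V →ₗ[ℝ] W) {k : V} (hk : k ≠ 0)
    (hD : LinearMap.ker D = Submodule.span ℝ {k}) {U : Submodule ℝ V} (hU : k ∈ U) :
    Module.finrank ℝ (U.map D) + 1 = Module.finrank ℝ U := by
  rw [← (D.domRestrict U).finrank_range_add_finrank_ker, LinearMap.range_domRestrict]
  congr 1
  have h : LinearMap.ker (D.domRestrict U) = Submodule.span ℝ {(⟨k, hU⟩ : U)} := by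
    ext ⟨v, hv⟩
    have := SetLike.ext_iff.1 hD v
    simp only [LinearMap.mem_ker, Submodule.mem_span_singleton] at this
    simp [LinearMap.mem_ker, Submodule.mem_span_singleton, this, Subtype.ext_iff]
  rw [h, finrank_span_singleton]
  simpa [Subtype.ext_iff] using hk

theorem finrank_map_of_notMem {V W : Type*} [AddCommGroup V] [Module ℝ V] [FiniteDimensional ℝ V]
    [AddCommGroup W] [Module ℝ W] (D : V →ₗ[ℝ] W) {k : V}
    (hD : LinearMap.ker D = Submodule.span ℝ {k}) {U : Submodule ℝ V} (hU : k ∉ U) :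
    Module.finrank ℝ (U.map D) = Module.finrank ℝ U := by
  rw [← (D.domRestrict U).finrank_range_add_finrank_ker, LinearMap.range_domRestrict]
  have h : LinearMap.ker (D.domRestrict U) = ⊥ := by
    rw [Submodule.eq_bot_iff]
    rintro ⟨v, hv⟩ h0
    have hv' : v ∈ LinearMap.ker D := h0
    rw [hD, Submodule.mem_span_singleton] at hv'
    obtain ⟨a, rfl⟩ := hv'
    rcases eq_or_ne a 0 with rfl | ha
    · simp
    · exact absurd ((U.smul_mem_iff ha).1 hv) hU
  rw [h, finrank_bot, add_zero]

theorem finrank_orthogonal_span {n : ℕ} {w : Fin n → E3} (hw : LinearIndependent ℝ w) :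
    n + Module.finrank ℝ (Submodule.span ℝ (Set.range w))ᗮ = 3 := by
  have h := (Submodule.span ℝ (Set.range w)).finrank_add_finrank_orthogonal
  rwa [finrank_span_eq_card hw, Fintype.card_fin, finrank_euclideanSpace_fin] at h

theorem mem_orthogonal_span_iff {ι : Type*} {w : ι → E3} {v : E3} :
    v ∈ (Submodule.span ℝ (Set.range w))ᗮ ↔ ∀ i, inner ℝ (w i) v = 0 := by
  rw [← ker_pi_inner]
  exact funext_iff

theorem inner_gradient_vec (P : Poly3) (V : Fin 3 → Poly3) (p : E3) :
    inner ℝ (∇ (ev P) p) (vec V p) = ev (grad P ⬝ᵥ V) p := by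
  rw [← derivAlong_ev, derivAlong]

theorem eventually_vec_ne_zero {V : Fin 3 → Poly3} (h : vec V p ≠ 0) :
    ∀ᶠ q in nhds p, vec V q ≠ 0 :=
  (contDiff_vec V (n := 0)).continuous.continuousAt.eventually_ne h

theorem isMultipleField_of_kernel (h₁ : ideal₁ f = ⊤) (hJ : ev (polyJ f) p = 0) {i j : Fin 3}
    (hK : vec (polyK f i j) p ≠ 0) {K' : E3 → E3} (hs : ContDiffAt ℝ ∞ K' p)
    (hK' : ∀ᶠ q in nhds p, ev (polyJ f) q = 0 → fderiv ℝ (polyMap f) q (K' q) = 0) :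
    ∃ c, IsMultipleField (ev (polyJ f)) (vec (polyK f i j)) K' c p := by
  refine ⟨_, .of_parallel (contDiff_ev _).contDiffAt (contDiff_vec _).contDiffAt hs hJ
    (gradient_polyJ_ne_zero h₁ hJ) hK ?_⟩
  filter_upwards [hK', eventually_vec_ne_zero hK] with q h1 h2 h3
  exact exists_eq_smul_vec_polyK h2 (h1 h3)

theorem isMultipleField_polyK (h₁ : ideal₁ f = ⊤) (hJ : ev (polyJ f) p = 0) {i j : Fin 3}
    (hK : vec (polyK f i j) p ≠ 0) (l m : Fin 3) :
    ∃ c, IsMultipleField (ev (polyJ f)) (vec (polyK f i j)) (vec (polyK f l m)) c p :=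
  isMultipleField_of_kernel h₁ hJ hK (contDiff_vec _).contDiffAt
    (.of_forall fun _ hq => fderiv_polyMap_vec_polyK hq l m)

/-- The tangent plane of `S₁` is `∇J(p)ᗮ`. Its image has dimension 1 rather than 2 exactly when it
contains the kernel line, that is when `⟨∇J, K_ij⟩ = 0`. -/
theorem mem_S₁₁_iff (h₁ : ideal₁ f = ⊤) (h₂ : ideal₂ f = ⊤) (hJ : ev (polyJ f) p = 0)
    {i j : Fin 3} (hK : vec (polyK f i j) p ≠ 0) :
    p ∈ S₁₁ (polyMap f) ↔ ev (polyX f i j) p = 0 := by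
  have hli : LinearIndependent ℝ fun _ : Fin 1 => ∇ (ev (polyJ f)) p :=
    LinearIndependent.of_subsingleton 0 (gradient_polyJ_ne_zero h₁ hJ)
  have hT : tangentSpaceOf (S₁ (polyMap f)) p =
      (Submodule.span ℝ (Set.range fun _ : Fin 1 => ∇ (ev (polyJ f)) p))ᗮ :=
    tangentSpaceOf_levelSet (F := fun _ : Fin 1 => ev (polyJ f))
      (fun _ => (contDiff_ev _).contDiffAt) hli (fun _ => hJ)
      (.of_forall fun q => by simp [mem_S₁_iff h₂])
  have hdim := finrank_orthogonal_span hli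
  have hmem : vec (polyK f i j) p ∈ tangentSpaceOf (S₁ (polyMap f)) p ↔
      ev (polyX f i j) p = 0 := by
    rw [hT, mem_orthogonal_span_iff]
    simp only [inner_gradient_vec, polyX, forall_const]
  rw [← hT] at hdim
  have hfin : Module.finrank ℝ (tangentSpaceOf (S₁ (polyMap f)) p) = 2 :=
    Nat.add_left_cancel (n := 1) (k := 2) hdim
  have hker := ker_fderiv_polyMap hJ hK
  rw [← hmem]
  refine ⟨fun h => ?_, fun h => ⟨(mem_S₁_iff h₂).2 hJ, ?_⟩⟩
  · by_contra hn
    have h1 := finrank_map_of_notMem _ hker hn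
    have h2 : Module.finrank ℝ ((tangentSpaceOf (S₁ (polyMap f)) p).map
      (fderiv ℝ (polyMap f) p).toLinearMap) = 1 := h.2
    lia
  · exact Nat.succ_injective ((finrank_map_of_mem _ hK hker h).trans hfin)

/-- The conditions defining `S₁₁` do not depend on the kernel field. -/
theorem ev_polyX_eq_zero (h₁ : ideal₁ f = ⊤) (hJ : ev (polyJ f) p = 0) {i j : Fin 3}
    (hK : vec (polyK f i j) p ≠ 0) (hX : ev (polyX f i j) p = 0) (l m : Fin 3) :
    ev (polyX f l m) p = 0 := by
  obtain ⟨c, hc⟩ := isMultipleField_polyK h₁ hJ hK l m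
  rw [polyX, ← inner_gradient_vec, hc.eq_smul.self_of_nhds hJ, inner_smul_right,
    inner_gradient_vec, ← polyX, hX, mul_zero]

/-- If `∇X_ij` were a multiple of `∇J`, so would be every `∇X_lm`, by the change-of-field formula.
All generators of `I₃` would then vanish at `p`. -/
theorem linearIndependent_gradient_pair (h₁ : ideal₁ f = ⊤) (h₃ : ideal₃ f = ⊤)
    (hJ : ev (polyJ f) p = 0) {i j : Fin 3} (hK : vec (polyK f i j) p ≠ 0)
    (hX : ev (polyX f i j) p = 0) :
    LinearIndependent ℝ ![∇ (ev (polyJ f)) p, ∇ (ev (polyX f i j)) p] := by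
  by_contra h
  rw [LinearIndependent.pair_iff' (gradient_polyJ_ne_zero h₁ hJ)] at h
  push Not at h
  obtain ⟨a, ha⟩ := h
  have hX0 := ev_polyX_eq_zero h₁ hJ hK hX
  have key : ∀ l m, ∃ t : ℝ, ∇ (ev (polyX f l m)) p = t • ∇ (ev (polyJ f)) p := by
    intro l m
    obtain ⟨c, hc⟩ := isMultipleField_polyK h₁ hJ hK l m
    obtain ⟨b, hb⟩ := hc.exists_gradient_derivAlong.self_of_nhds hJ
    rw [derivAlong_ev, derivAlong_ev, ← polyX, ← polyX, hX, zero_smul, add_zero, ← ha, smul_smul,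
      ← add_smul] at hb
    exact ⟨_, hb⟩
  have rows : ∀ r : Fin 4, ∃ t : ℝ, ∀ s : Fin 3,
      ev (derivMatrix ![polyJ f, polyX f 0 1, polyX f 0 2, polyX f 1 2] r s) p =
        t * ev (grad (polyJ f) s) p := by
    have aux : ∀ P : Poly3, (∃ t : ℝ, ∇ (ev P) p = t • ∇ (ev (polyJ f)) p) →
        ∃ t : ℝ, ∀ s : Fin 3, ev (grad P s) p = t * ev (grad (polyJ f) s) p := by
      rintro P ⟨t, ht⟩
      rw [gradient_ev, gradient_ev] at ht
      exact ⟨t, fun s => congrArg (fun w : E3 => w s) ht⟩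
    intro r
    fin_cases r
    · exact aux _ ⟨1, (one_smul _ _).symm⟩
    · exact aux _ (key 0 1)
    · exact aux _ (key 0 2)
    · exact aux _ (key 1 2)
  refine not_forall_ev_eq_zero (p := p) h₃ ?_
  rintro P (hP | ⟨r, r', s, s', -, -, rfl⟩)
  · simp only [Set.mem_insert_iff, Set.mem_singleton_iff] at hP
    rcases hP with rfl | rfl | rfl | rfl
    exacts [hJ, hX0 _ _, hX0 _ _, hX0 _ _]
  · obtain ⟨t, ht⟩ := rows r
    obtain ⟨t', ht'⟩ := rows r'
    rw [Matrix.det_fin_two_of, ev_sub, ev_mul, ev_mul, ht, ht, ht', ht']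
    ring

/-- The tangent line of `S₁₁` is orthogonal to `∇J` and `∇X_ij`. It maps to zero exactly when it
contains `K_ij`; as `X_ij = 0` already, this means `Y_ij = 0`. -/
theorem mem_S₁₁₁_iff_of_ne_zero (h₁ : ideal₁ f = ⊤) (h₂ : ideal₂ f = ⊤) (h₃ : ideal₃ f = ⊤)
    (hJ : ev (polyJ f) p = 0) {i j : Fin 3} (hK : vec (polyK f i j) p ≠ 0) :
    p ∈ S₁₁₁ (polyMap f) ↔ ev (polyX f i j) p = 0 ∧ ev (polyY f i j) p = 0 := by
  rw [← mem_S₁₁_iff h₁ h₂ hJ hK]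
  refine and_congr_right fun hp => ?_
  have hX := (mem_S₁₁_iff h₁ h₂ hJ hK).1 hp
  have hli := linearIndependent_gradient_pair h₁ h₃ hJ hK hX
  have e : (fun i' => ∇ ((![ev (polyJ f), ev (polyX f i j)] : Fin 2 → E3 → ℝ) i') p) =
      ![∇ (ev (polyJ f)) p, ∇ (ev (polyX f i j)) p] := by
    ext i : 1; fin_cases i <;> rfl
  have hT := tangentSpaceOf_levelSet (S := S₁₁ (polyMap f))
      (F := ![ev (polyJ f), ev (polyX f i j)]) (p := p)
      (by simp [Fin.forall_fin_two, (contDiff_ev _).contDiffAt]) (e ▸ hli)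
      (by simp [Fin.forall_fin_two, hJ, hX]) (by
        -- The same pair `i, j` serves near `p`, where `K_ij` stays nonzero.
        filter_upwards [eventually_vec_ne_zero hK] with q hq
        simp only [Fin.forall_fin_two, Matrix.cons_val_zero, Matrix.cons_val_one]
        constructor
        · intro h
          have h0 := (mem_S₁_iff h₂).1 h.1
          exact ⟨h0, (mem_S₁₁_iff h₁ h₂ h0 hq).1 h⟩
        · rintro ⟨h0, h1⟩
          exact (mem_S₁₁_iff h₁ h₂ h0 hq).2 h1)
  rw [e] at hT
  have hdim := finrank_orthogonal_span hli
  have hmem : vec (polyK f i j) p ∈ tangentSpaceOf (S₁₁ (polyMap f)) p ↔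
      ev (polyY f i j) p = 0 := by
    rw [hT, mem_orthogonal_span_iff]
    rw [polyX] at hX
    simp only [Fin.forall_fin_two, Matrix.cons_val_zero, Matrix.cons_val_one, inner_gradient_vec]
    exact and_iff_right hX
  rw [← hT] at hdim
  have hfin : Module.finrank ℝ (tangentSpaceOf (S₁₁ (polyMap f)) p) = 1 :=
    Nat.add_left_cancel (n := 2) (k := 1) hdim
  have hker := ker_fderiv_polyMap hJ hK
  rw [← hmem, rankRestrict]
  refine ⟨fun h => ?_, fun h => ?_⟩
  · by_contra hn
    have h1 := finrank_map_of_notMem _ hker hn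
    lia
  · exact Nat.succ_injective ((finrank_map_of_mem _ hK hker h).trans hfin)

theorem ev_polyY_eq_zero (h₁ : ideal₁ f = ⊤) (hJ : ev (polyJ f) p = 0) {i j : Fin 3}
    (hK : vec (polyK f i j) p ≠ 0) (hX : ev (polyX f i j) p = 0) (hY : ev (polyY f i j) p = 0)
    (l m : Fin 3) : ev (polyY f l m) p = 0 := by
  obtain ⟨c, hc⟩ := isMultipleField_polyK h₁ hJ hK l m
  have h := hc.derivAlong_derivAlong.self_of_nhds hJ
  simp only [derivAlong_ev] at h
  rw [polyY, polyX, h hX, ← polyX, ← polyY, hY, mul_zero]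

/-- `S₁₁₁` is the real zero set of the ideal `I`. -/
theorem mem_S₁₁₁_iff (h₁ : ideal₁ f = ⊤) (h₂ : ideal₂ f = ⊤) (h₃ : ideal₃ f = ⊤) :
    p ∈ S₁₁₁ (polyMap f) ↔ ∀ P ∈ idealI f, ev P p = 0 := by
  constructor
  · intro hp
    have hJ := (mem_S₁_iff h₂).1 hp.1.1
    obtain ⟨i, j, -, hK⟩ := exists_vec_polyK_ne_zero h₂ hJ
    obtain ⟨hX, hY⟩ := (mem_S₁₁₁_iff_of_ne_zero h₁ h₂ h₃ hJ hK).1 hp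
    have hX' := ev_polyX_eq_zero h₁ hJ hK hX
    have hY' := ev_polyY_eq_zero h₁ hJ hK hX hY
    have hle : idealI f ≤ RingHom.ker (eval fun j => p j) := Ideal.span_le.2 (by
      rintro P (rfl | rfl | rfl | rfl | rfl | rfl | rfl)
      exacts [hJ, hX' _ _, hX' _ _, hX' _ _, hY' _ _, hY' _ _, hY' _ _])
    exact fun P hP => hle hP
  · intro h
    have hJ : ev (polyJ f) p = 0 := h _ (Ideal.subset_span (by simp))
    obtain ⟨i, j, hij, hK⟩ := exists_vec_polyK_ne_zero h₂ hJ
    refine (mem_S₁₁₁_iff_of_ne_zero h₁ h₂ h₃ hJ hK).2 ⟨h _ ?_, h _ ?_⟩ <;>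
    · refine Ideal.subset_span ?_
      fin_cases i <;> fin_cases j <;> first | exact absurd hij (by decide) | simp

end Geometry

section Points

variable {f : Fin 3 → Poly3} {p : E3}

/-! ### Real points of the algebra -/

/-- The real point of the algebra `ℝ[x,y,z]/I` given by a real zero of `I`. -/
def pointHom (hp : ∀ P ∈ idealI f, ev P p = 0) : AlgA f →ₐ[ℝ] ℝ :=
  Ideal.Quotient.liftₐ (idealI f) (aeval fun j => p j) fun P hP => by
    simpa [ev, aeval_eq_eval] using hp P hP

theorem pointHom_mk (hp : ∀ P ∈ idealI f, ev P p = 0) (P : Poly3) :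
    pointHom hp (Ideal.Quotient.mk (idealI f) P) = ev P p := by
  change aeval (fun j => p j) P = _
  simp [ev, aeval_eq_eval]

/-- The real zeros of `I` are the real points of the algebra `ℝ[x,y,z]/I`. -/
def realPointEquiv (f : Fin 3 → Poly3) :
    {p : E3 // ∀ P ∈ idealI f, ev P p = 0} ≃ (AlgA f →ₐ[ℝ] ℝ) where
  toFun p := pointHom p.2
  invFun φ := ⟨WithLp.toLp 2 fun j => φ (Ideal.Quotient.mk _ (X j)), fun P hP => by
    have h : (φ.comp (Ideal.Quotient.mkₐ ℝ (idealI f))) P = 0 := by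
      simp [Ideal.Quotient.eq_zero_iff_mem.2 hP]
    rw [aeval_unique (φ.comp (Ideal.Quotient.mkₐ ℝ (idealI f)))] at h
    exact h⟩
  left_inv p := by
    ext j
    simp [pointHom_mk]
  right_inv φ := by
    refine Ideal.Quotient.algHom_ext _ (MvPolynomial.algHom_ext fun j => ?_)
    simp [pointHom_mk]

/-! ### Linear independence of the gradients -/

theorem vec_grad_mul (P Q : Poly3) (p : E3) :
    vec (grad (P * Q)) p = ev P p • vec (grad Q) p + ev Q p • vec (grad P) p := by
  ext j
  simp [grad]

/-- By the Leibniz rule, at a common zero the gradient of `aP` is `a(p) ∇P(p)`, so checking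
generators suffices. -/
theorem ev_and_grad_of_mem_span {s : Set Poly3} {N : Submodule ℝ E3}
    (hs : ∀ P ∈ s, ev P p = 0 ∧ vec (grad P) p ∈ N) {P : Poly3} (hP : P ∈ Ideal.span s) :
    ev P p = 0 ∧ vec (grad P) p ∈ N := by
  induction hP using Submodule.span_induction with
  | mem P hP => exact hs P hP
  | zero =>
    have h : vec (grad (0 : Poly3)) p = 0 := by ext j; simp [grad]
    simp [h]
  | add P Q _ _ hP hQ =>
    have h : vec (grad (P + Q)) p = vec (grad P) p + vec (grad Q) p := by ext j; simp [grad]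
    rw [h]
    exact ⟨by simp [hP.1, hQ.1], N.add_mem hP.2 hQ.2⟩
  | smul a P _ hP =>
    rw [smul_eq_mul, vec_grad_mul, hP.1, zero_smul, add_zero]
    exact ⟨by simp [hP.1], N.smul_mem _ hP.2⟩

/-- If the algebra is reduced, the differentials of `I` at a real zero span the cotangent space. -/
theorem eq_top_of_grad_mem [FiniteDimensional ℝ (AlgA f)] [IsReduced (AlgA f)]
    (hp : ∀ P ∈ idealI f, ev P p = 0) {N : Submodule ℝ E3}
    (hN : ∀ P ∈ idealI f, vec (grad P) p ∈ N) : N = ⊤ := by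
  obtain ⟨e, he, hann⟩ := exists_annihilator_of_realPoint (pointHom hp)
  obtain ⟨E, rfl⟩ := Ideal.Quotient.mk_surjective e
  rw [pointHom_mk] at he
  -- The product `(X j - p j) E` lies in `I`, and its gradient at `p` is `E(p)` times the `j`-th
  -- basis vector.
  have hb : ∀ j : Fin 3, EuclideanSpace.single j (1 : ℝ) ∈ N := by
    intro j
    have h0 : ev (X j - C (p j)) p = 0 := by simp
    have h1 := hann (Ideal.Quotient.mk _ (X j - C (p j))) (by rw [pointHom_mk, h0])
    rw [← map_mul, Ideal.Quotient.eq_zero_iff_mem] at h1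
    have h2 := hN _ h1
    rw [vec_grad_mul, h0, zero_smul, zero_add, N.smul_mem_iff he] at h2
    convert h2 using 1
    ext l
    simp only [vec_apply, grad, map_sub, pderiv_C, sub_zero, pderiv_X]
    rcases eq_or_ne l j with rfl | h
    · simp
    · simp [h, h.symm]
  rw [eq_top_iff, ← (EuclideanSpace.basisFun (Fin 3) ℝ).toBasis.span_eq, Submodule.span_le]
  rintro _ ⟨j, rfl⟩
  simpa using hb j

theorem gradients_polyMap (f : Fin 3 → Poly3) (i j : Fin 3) (p : E3) :
    gradients (polyMap f) (vec (polyK f i j)) p =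
      ![∇ (ev (polyJ f)) p, ∇ (ev (polyX f i j)) p, ∇ (ev (polyY f i j)) p] := by
  rw [gradients, jacobian_polyMap, fieldX_polyMap, fieldY_polyMap]

theorem exists_gradient_polyX (h₁ : ideal₁ f = ⊤) (hJ : ev (polyJ f) p = 0) {i j : Fin 3}
    (hK : vec (polyK f i j) p ≠ 0) (hX : ev (polyX f i j) p = 0) (l m : Fin 3) :
    ∃ a b : ℝ, ∇ (ev (polyX f l m)) p =
      a • ∇ (ev (polyX f i j)) p + b • ∇ (ev (polyJ f)) p := by
  obtain ⟨c, hc⟩ := isMultipleField_polyK h₁ hJ hK l m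
  obtain ⟨b, hb⟩ := hc.exists_gradient_derivAlong.self_of_nhds hJ
  rw [derivAlong_ev, derivAlong_ev, ← polyX, ← polyX, hX, zero_smul, add_zero] at hb
  exact ⟨_, _, hb⟩

theorem exists_gradient_polyY (h₁ : ideal₁ f = ⊤) (h₃ : ideal₃ f = ⊤)
    (hJ : ev (polyJ f) p = 0) {i j : Fin 3}
    (hK : vec (polyK f i j) p ≠ 0) (hX : ev (polyX f i j) p = 0) (hY : ev (polyY f i j) p = 0)
    (l m : Fin 3) : ∃ a b d : ℝ, ∇ (ev (polyY f l m)) p =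
      a • ∇ (ev (polyY f i j)) p + b • ∇ (ev (polyJ f)) p + d • ∇ (ev (polyX f i j)) p := by
  obtain ⟨c, hc⟩ := isMultipleField_polyK h₁ hJ hK l m
  have hli := linearIndependent_gradient_pair h₁ h₃ hJ hK hX
  obtain ⟨b, d, hbd⟩ := hc.exists_gradient_derivAlong_derivAlong
    (by rw [derivAlong_ev, ← polyX, hX]) (by rw [derivAlong_ev, derivAlong_ev, ← polyX, ← polyY, hY])
    (by rwa [derivAlong_ev, ← polyX])
  simp only [derivAlong_ev] at hbd
  exact ⟨_, b, d, hbd⟩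

/-- The three gradients span those of all generators of `I`, hence the whole space by reducedness;
three spanning vectors in dimension 3 are independent. -/
theorem linearIndependent_gradients [FiniteDimensional ℝ (AlgA f)] [IsReduced (AlgA f)]
    (h₁ : ideal₁ f = ⊤) (h₃ : ideal₃ f = ⊤) (hp : ∀ P ∈ idealI f, ev P p = 0)
    (hJ : ev (polyJ f) p = 0) {i j : Fin 3} (hK : vec (polyK f i j) p ≠ 0)
    (hX : ev (polyX f i j) p = 0) (hY : ev (polyY f i j) p = 0) :
    LinearIndependent ℝ (gradients (polyMap f) (vec (polyK f i j)) p) := by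
  rw [gradients_polyMap]
  refine linearIndependent_of_top_le_span_of_card_eq_finrank ?_ (by simp)
  set w : Fin 3 → E3 :=
    ![∇ (ev (polyJ f)) p, ∇ (ev (polyX f i j)) p, ∇ (ev (polyY f i j)) p] with hw
  have m0 : ∇ (ev (polyJ f)) p ∈ Submodule.span ℝ (Set.range w) := Submodule.subset_span ⟨0, rfl⟩
  have m1 : ∇ (ev (polyX f i j)) p ∈ Submodule.span ℝ (Set.range w) :=
    Submodule.subset_span ⟨1, rfl⟩
  have m2 : ∇ (ev (polyY f i j)) p ∈ Submodule.span ℝ (Set.range w) :=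
    Submodule.subset_span ⟨2, rfl⟩
  have mX : ∀ l m, vec (grad (polyX f l m)) p ∈ Submodule.span ℝ (Set.range w) := by
    intro l m
    obtain ⟨a, b, h⟩ := exists_gradient_polyX h₁ hJ hK hX l m
    rw [← gradient_ev, h]
    exact add_mem (Submodule.smul_mem _ _ m1) (Submodule.smul_mem _ _ m0)
  have mY : ∀ l m, vec (grad (polyY f l m)) p ∈ Submodule.span ℝ (Set.range w) := by
    intro l m
    obtain ⟨a, b, d, h⟩ := exists_gradient_polyY h₁ h₃ hJ hK hX hY l m
    rw [← gradient_ev, h]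
    exact add_mem (add_mem (Submodule.smul_mem _ _ m2) (Submodule.smul_mem _ _ m0))
      (Submodule.smul_mem _ _ m1)
  refine (eq_top_of_grad_mem hp fun P hP => (ev_and_grad_of_mem_span (fun Q hQ => ?_) hP).2).ge
  refine ⟨hp Q (Ideal.subset_span hQ), ?_⟩
  rcases hQ with rfl | rfl | rfl | rfl | rfl | rfl | rfl
  exacts [by rwa [← gradient_ev], mX _ _, mX _ _, mX _ _, mY _ _, mY _ _, mY _ _]

theorem isSimpleSwallowtailWith_polyK [FiniteDimensional ℝ (AlgA f)] [IsReduced (AlgA f)]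
    (h₁ : ideal₁ f = ⊤) (h₂ : ideal₂ f = ⊤) (h₃ : ideal₃ f = ⊤)
    (hp : p ∈ S₁₁₁ (polyMap f)) {i j : Fin 3} (hK : vec (polyK f i j) p ≠ 0) :
    IsSimpleSwallowtailWith (polyMap f) p (vec (polyK f i j)) := by
  have hJ := (mem_S₁_iff h₂).1 hp.1.1
  obtain ⟨hX, hY⟩ := (mem_S₁₁₁_iff_of_ne_zero h₁ h₂ h₃ hJ hK).1 hp
  exact {
    smooth := (contDiff_polyMap f).contDiffAt
    rank_eq := hp.1.1
    kernelField := {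
      smooth := (contDiff_vec _).contDiffAt
      ne_zero := hK
      mem_ker := .of_forall fun q hq => fderiv_polyMap_vec_polyK ((mem_S₁_iff h₂).1 hq) i j }
    J_eq := by rw [jacobian_polyMap, hJ]
    X_eq := by rw [fieldX_polyMap, hX]
    Y_eq := by rw [fieldY_polyMap, hY]
    linearIndependent := linearIndependent_gradients h₁ h₃ ((mem_S₁₁₁_iff h₁ h₂ h₃).1 hp) hJ hK hX hY }

/-! ### The sign of a swallowtail -/

theorem ev_polyG (f : Fin 3 → Poly3) (i j : Fin 3) (p : E3) :
    ev (polyG f i j) p = fieldZ (polyMap f) (vec (polyK f i j)) p *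
      (Matrix.of fun r s => gradients (polyMap f) (vec (polyK f i j)) p r s).det := by
  rw [polyG, ev_mul, ev_det, fieldZ_polyMap, gradients_polyMap]
  congr 2
  ext r s
  fin_cases r <;> simp [derivMatrix, gradient_ev]

/-- The arbitrarily chosen field is `c K_ij` along `{J = 0}` with `c(p) ≠ 0`, so the sign data
differ by the positive factor `c(p)⁶`. -/
theorem swallowtailSign_eq (h₁ : ideal₁ f = ⊤) (h₂ : ideal₂ f = ⊤) (h₃ : ideal₃ f = ⊤)
    (hp : p ∈ S₁₁₁ (polyMap f)) (hs : IsSimpleSwallowtail (polyMap f) p) {i j : Fin 3}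
    (hK : vec (polyK f i j) p ≠ 0) :
    swallowtailSign (polyMap f) p = SignType.sign (ev (polyG f i j) p) := by
  have hJ := (mem_S₁_iff h₂).1 hp.1.1
  obtain ⟨hX, hY⟩ := (mem_S₁₁₁_iff_of_ne_zero h₁ h₂ h₃ hJ hK).1 hp
  rw [swallowtailSign, dif_pos hs]
  have hspec := hs.choose_spec
  generalize hs.choose = K' at hspec
  obtain ⟨c, hc⟩ := isMultipleField_of_kernel h₁ hJ hK hspec.kernelField.smooth (by
    filter_upwards [hspec.kernelField.mem_ker] with q hq h0 using hq ((mem_S₁_iff h₂).2 h0))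
  have hc0 : c p ≠ 0 := by
    intro h
    refine hspec.kernelField.ne_zero ?_
    rw [hc.eq_smul.self_of_nhds hJ, h, zero_smul]
  have hli := linearIndependent_gradient_pair h₁ h₃ hJ hK hX
  have key := hc.sign_data (by rw [derivAlong_ev, ← polyX, hX])
    (by rw [derivAlong_ev, derivAlong_ev, ← polyX, ← polyY, hY]) (by rwa [derivAlong_ev, ← polyX])
  rw [← jacobian_polyMap] at key
  rw [ev_polyG]
  have key' : fieldZ (polyMap f) K' p *
      (Matrix.of fun r s => gradients (polyMap f) K' p r s).det =
      c p ^ 6 * (fieldZ (polyMap f) (vec (polyK f i j)) p *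
      (Matrix.of fun r s => gradients (polyMap f) (vec (polyK f i j)) p r s).det) := key
  rw [key', sign_mul, sign_pos (by positivity), one_mul]

theorem ev_polyG_eq_zero {i j : Fin 3} (hK : vec (polyK f i j) p = 0) :
    ev (polyG f i j) p = 0 := by
  rw [ev_polyG, fieldZ, derivAlong, hK, inner_zero_right, zero_mul]

/-- Each `g_ij(p)` is zero, when `K_ij(p) = 0`, or has the swallowtail sign; a nonvanishing
combination with nonnegative coefficients keeps that sign. -/
theorem sign_ev_combination (h₁ : ideal₁ f = ⊤) (h₂ : ideal₂ f = ⊤) (h₃ : ideal₃ f = ⊤)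
    (hp : p ∈ S₁₁₁ (polyMap f)) (hs : IsSimpleSwallowtail (polyMap f) p) {a b c : ℝ}
    (ha : 0 ≤ a) (hb : 0 ≤ b) (hc : 0 ≤ c) {g : Poly3}
    (hg : g = C a * polyG f 0 1 + C b * polyG f 0 2 + C c * polyG f 1 2) (hne : ev g p ≠ 0) :
    SignType.sign (ev g p) = swallowtailSign (polyMap f) p := by
  have hG : ∀ i j, ev (polyG f i j) p = 0 ∨
      SignType.sign (ev (polyG f i j) p) = swallowtailSign (polyMap f) p := by
    intro i j
    by_cases hK : vec (polyK f i j) p = 0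
    · exact .inl (ev_polyG_eq_zero hK)
    · exact .inr (swallowtailSign_eq h₁ h₂ h₃ hp hs hK).symm
  have hgp : ev g p = a * ev (polyG f 0 1) p + b * ev (polyG f 0 2) p + c * ev (polyG f 1 2) p := by
    simp [hg]
  have h01 := hG 0 1
  have h02 := hG 0 2
  have h12 := hG 1 2
  generalize swallowtailSign (polyMap f) p = s at *
  generalize ev (polyG f 0 1) p = x at *
  generalize ev (polyG f 0 2) p = y at *
  generalize ev (polyG f 1 2) p = z at *
  rcases s with _ | _ | _
  · have h {t : ℝ} (ht : t = 0 ∨ SignType.sign t = SignType.zero) : t = 0 :=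
      ht.elim id sign_eq_zero_iff.1
    rw [h h01, h h02, h h12] at hgp
    simp at hgp
    exact absurd hgp hne
  · have h {t : ℝ} (ht : t = 0 ∨ SignType.sign t = SignType.neg) : t ≤ 0 :=
      ht.elim le_of_eq fun h => (sign_eq_neg_one_iff.1 h).le
    refine sign_neg (lt_of_le_of_ne ?_ hne)
    rw [hgp]
    have := mul_nonpos_of_nonneg_of_nonpos ha (h h01)
    have := mul_nonpos_of_nonneg_of_nonpos hb (h h02)
    have := mul_nonpos_of_nonneg_of_nonpos hc (h h12)
    linarith
  · have h {t : ℝ} (ht : t = 0 ∨ SignType.sign t = SignType.pos) : 0 ≤ t :=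
      ht.elim ge_of_eq fun h => (sign_eq_one_iff.1 h).le
    refine sign_pos (lt_of_le_of_ne ?_ hne.symm)
    rw [hgp]
    have := mul_nonneg ha (h h01)
    have := mul_nonneg hb (h h02)
    have := mul_nonneg hc (h h12)
    linarith

/-! ### Counting -/

theorem finite_S₁₁₁ [FiniteDimensional ℝ (AlgA f)]
    (h₁ : ideal₁ f = ⊤) (h₂ : ideal₂ f = ⊤) (h₃ : ideal₃ f = ⊤) :
    (S₁₁₁ (polyMap f)).Finite := by
  have e : S₁₁₁ (polyMap f) = {p | ∀ P ∈ idealI f, ev P p = 0} :=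
    Set.ext fun p => mem_S₁₁₁_iff h₁ h₂ h₃
  rw [e]
  exact Set.finite_coe_iff.1 (Finite.of_equiv _ (realPointEquiv f).symm)

theorem signature_traceQuad [FiniteDimensional ℝ (AlgA f)] [IsReduced (AlgA f)]
    (h₁ : ideal₁ f = ⊤) (h₂ : ideal₂ f = ⊤) (h₃ : ideal₃ f = ⊤)
    (hfin : (S₁₁₁ (polyMap f)).Finite) (v : Poly3) :
    signature (traceQuad f v) = ∑ p ∈ hfin.toFinset, (SignType.sign (ev v p) : ℤ) := by
  have : Fintype (AlgA f →ₐ[ℝ] ℝ) := Fintype.ofFinite _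
  rw [traceQuad_eq_traceSq, signature_traceSq]
  symm
  refine Finset.sum_bij'
    (fun p hp => pointHom ((mem_S₁₁₁_iff h₁ h₂ h₃).1 (hfin.mem_toFinset.1 hp)))
    (fun φ _ => ((realPointEquiv f).symm φ).1) (fun _ _ => Finset.mem_univ _) (fun φ _ => ?_)
    (fun p hp => ?_) (fun φ _ => ?_) (fun p hp => ?_)
  · exact hfin.mem_toFinset.2 ((mem_S₁₁₁_iff h₁ h₂ h₃).2 ((realPointEquiv f).symm φ).2)
  · exact congrArg Subtype.val ((realPointEquiv f).symm_apply_apply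
      ⟨p, (mem_S₁₁₁_iff h₁ h₂ h₃).1 (hfin.mem_toFinset.1 hp)⟩)
  · exact (realPointEquiv f).apply_symm_apply φ
  · rw [pointHom_mk]

theorem ev_ne_zero_of_nondegenerate [FiniteDimensional ℝ (AlgA f)] {v : Poly3}
    (hv : (traceQuad f v).Nondegenerate) (hp : ∀ P ∈ idealI f, ev P p = 0) : ev v p ≠ 0 := by
  have h := (isUnit_of_traceSq_nondegenerate hv).map (pointHom hp)
  rw [pointHom_mk] at h
  exact h.ne_zero

end Points

end

end Swallowtail

open Swallowtail
theorem theorem8p7 (f : Fin 3 → Poly3)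
    (h₁ : ideal₁ f = ⊤) (h₂ : ideal₂ f = ⊤) (h₃ : ideal₃ f = ⊤)
    (hfin : FiniteDimensional ℝ (AlgA f))
    (α₁₂ α₁₃ α₂₃ : ℝ) (hα₁₂ : 0 ≤ α₁₂) (hα₁₃ : 0 ≤ α₁₃) (hα₂₃ : 0 ≤ α₂₃)
    (hα : 0 < α₁₂ ∨ 0 < α₁₃ ∨ 0 < α₂₃)
    (g : Poly3) (hg : g = C α₁₂ * polyG f 0 1 + C α₁₃ * polyG f 0 2 + C α₂₃ * polyG f 1 2)
    (u : Poly3)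
    (Θ Ψ Φ₁ Φ₂ : QuadraticForm ℝ (AlgA f))
    (hΘ : Θ = traceQuad f 1) (hΨ : Ψ = traceQuad f g)
    (hΦ₁ : Φ₁ = traceQuad f u) (hΦ₂ : Φ₂ = traceQuad f (u * g))
    (ndΨ : Ψ.Nondegenerate) (ndΦ₁ : Φ₁.Nondegenerate) (ndΦ₂ : Φ₂.Nondegenerate) :
    (S₁₁₁ (polyMap f)).Finite ∧
    (∀ p ∈ S₁₁₁ (polyMap f), IsSimpleSwallowtail (polyMap f) p) ∧
    (({p | p ∈ S₁₁₁ (polyMap f) ∧ 0 < eval (fun i => p i) u}.ncard : ℚ) =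
      ((signature Θ + signature Φ₁ : ℤ) : ℚ) / 2) ∧
    (({p | p ∈ S₁₁₁ (polyMap f) ∧ swallowtailSign (polyMap f) p = 1 ∧
        0 < eval (fun i => p i) u}.ncard : ℚ) =
      ((signature Θ + signature Ψ + signature Φ₁ + signature Φ₂ : ℤ) : ℚ) / 4) ∧
    (({p | p ∈ S₁₁₁ (polyMap f) ∧ swallowtailSign (polyMap f) p = -1 ∧
        0 < eval (fun i => p i) u}.ncard : ℚ) =
      ((signature Θ - signature Ψ + signature Φ₁ - signature Φ₂ : ℤ) : ℚ) / 4) := by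
  subst hΘ hΨ hΦ₁ hΦ₂
  have hred : IsReduced (AlgA f) := isReduced_of_traceSq_nondegenerate ndΦ₁
  have hF := finite_S₁₁₁ h₁ h₂ h₃
  have hsw : ∀ p ∈ S₁₁₁ (polyMap f), IsSimpleSwallowtail (polyMap f) p := by
    intro p hp
    obtain ⟨i, j, -, hK⟩ := exists_vec_polyK_ne_zero h₂ ((mem_S₁_iff h₂).1 hp.1.1)
    exact ⟨_, isSimpleSwallowtailWith_polyK h₁ h₂ h₃ hp hK⟩
  have hg0 : ∀ p ∈ S₁₁₁ (polyMap f), ev g p ≠ 0 := fun p hp =>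
    ev_ne_zero_of_nondegenerate ndΨ ((mem_S₁₁₁_iff h₁ h₂ h₃).1 hp)
  have hu0 : ∀ p ∈ S₁₁₁ (polyMap f), ev u p ≠ 0 := fun p hp =>
    ev_ne_zero_of_nondegenerate ndΦ₁ ((mem_S₁₁₁_iff h₁ h₂ h₃).1 hp)
  have hsg : ∀ p ∈ S₁₁₁ (polyMap f),
      swallowtailSign (polyMap f) p = SignType.sign (ev g p) := fun p hp =>
    (sign_ev_combination h₁ h₂ h₃ hp (hsw p hp) hα₁₂ hα₁₃ hα₂₃ hg (hg0 p hp)).symm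
  have hσ := signature_traceQuad h₁ h₂ h₃ hF
  have hcount : ∀ Q : E3 → Prop, ∀ _ : DecidablePred Q,
      ({p | p ∈ S₁₁₁ (polyMap f) ∧ Q p}.ncard : ℤ) = ∑ p ∈ hF.toFinset, if Q p then 1 else 0 := by
    intro Q _
    have e : {p | p ∈ S₁₁₁ (polyMap f) ∧ Q p} = (hF.toFinset.filter Q : Set E3) := by
      ext p; simp
    rw [e, Set.ncard_coe_finset, Finset.card_filter]
    push_cast
    rfl
  refine ⟨hF, hsw, ?_, ?_, ?_⟩
  · rw [eq_div_iff two_ne_zero]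
    have h : ({p | p ∈ S₁₁₁ (polyMap f) ∧ 0 < ev u p}.ncard : ℤ) * 2 =
        signature (traceQuad f 1) + signature (traceQuad f u) := by
      rw [hcount _ (Classical.decPred _), hσ, hσ, Finset.sum_mul, ← Finset.sum_add_distrib]
      refine Finset.sum_congr rfl fun p hp => ?_
      -- Pointwise, `1 + sgn u` is twice the indicator of `u > 0`.
      rcases (hu0 p (hF.mem_toFinset.1 hp)).lt_or_gt with hu | hu
      · simp [hu, hu.not_gt]
      · simp [hu]
    exact_mod_cast h
  · rw [eq_div_iff four_ne_zero]
    have h : ({p | p ∈ S₁₁₁ (polyMap f) ∧ swallowtailSign (polyMap f) p = 1 ∧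
        0 < ev u p}.ncard : ℤ) * 4 = signature (traceQuad f 1) + signature (traceQuad f g) +
          signature (traceQuad f u) + signature (traceQuad f (u * g)) := by
      rw [hcount _ (Classical.decPred _), hσ, hσ, hσ, hσ, Finset.sum_mul,
        ← Finset.sum_add_distrib, ← Finset.sum_add_distrib, ← Finset.sum_add_distrib]
      refine Finset.sum_congr rfl fun p hp => ?_
      have hp' := hF.mem_toFinset.1 hp
      -- Pointwise, the right side is `(1 + sgn g)(1 + sgn u)`, four times the indicator of `g > 0,
      -- u > 0`.
      rcases (hu0 p hp').lt_or_gt with hu | hu <;> rcases (hg0 p hp').lt_or_gt with hg | hg <;>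
        simp [hsg p hp', hu, hg, sign_mul, hu.not_gt]
    exact_mod_cast h
  · rw [eq_div_iff four_ne_zero]
    have h : ({p | p ∈ S₁₁₁ (polyMap f) ∧ swallowtailSign (polyMap f) p = -1 ∧
        0 < ev u p}.ncard : ℤ) * 4 = signature (traceQuad f 1) - signature (traceQuad f g) +
          signature (traceQuad f u) - signature (traceQuad f (u * g)) := by
      rw [hcount _ (Classical.decPred _), hσ, hσ, hσ, hσ, Finset.sum_mul,
        ← Finset.sum_sub_distrib, ← Finset.sum_add_distrib, ← Finset.sum_sub_distrib]
      refine Finset.sum_congr rfl fun p hp => ?_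
      have hp' := hF.mem_toFinset.1 hp
      -- Here it is `(1 - sgn g)(1 + sgn u)`.
      rcases (hu0 p hp').lt_or_gt with hu | hu <;> rcases (hg0 p hp').lt_or_gt with hg | hg <;>
        simp [hsg p hp', hu, hg, sign_mul, hu.not_gt]
    exact_mod_cast h
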